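/- For $\alpha\in\mathbb R$ let $f(v,\alpha)=v^3-\alpha v^2-1$ and consider the planar system $$\frac{dv}{d\tau}=v f(v,\alpha)+z^2,\qquad \frac{dz}{d\tau}=z f(v,\alpha).\qquad(\ast)$$ For $\alpha<-3/\sqrt[3]{4}$ the cubic $f(\cdot,\alpha)$ has three distinct real roots $v_1^0(\alpha)<v_2^0(\alpha)<0<v_3^0(\alpha)$. Let $L^-(\alpha)$ be the unstable separatrix of the saddle $P_1(\alpha)=(v_1^0(\alpha),0)$ in the half plane $z>0$, i.e. the trajectory in $z>0$ that tends to $P_1(\alpha)$ as $\tau\to-\infty$, and let $L^+(\alpha)$ be the stable separatrix of the saddle $P_3(\alpha)=(v_3^0(\alpha),0)$ in $z>0$, i.e. the trajectory in $z>0$ that tends to $P_3(\alpha)$ as $\tau\to+\infty$. Let $\phi^-(\cdot\,;\alpha)$ be the function of $v$ whose graph is the maximal arc, with $dv/d\tau=vf(v,\alpha)+z^2>0$ along it, of $L^-(\alpha)$ through a point of $L^-(\alpha)$ with $v_1^0(\alpha)<v<v_2^0(\alpha)$ and $vf(v,\alpha)+z^2>0$; let $\phi^+(\cdot\,;\alpha)$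 be the function whose graph is the maximal such arc of $L^+(\alpha)$ through a point of $L^+(\alpha)$ with $v_2^0(\alpha)\le v<v_3^0(\alpha)$ and $vf(v,\alpha)+z^2>0$. Let $v^-(\alpha)\in(-\infty,+\infty]$ be the supremum of $v$ on the first arc and $v^+(\alpha)\in[-\infty,+\infty)$ the infimum of $v$ on the second. If $v^-(\alpha)=0$, put $\phi^-(0;\alpha)=\lim_{v\to0^-}\phi^-(v;\alpha)$. Assume $b<a<-3/\sqrt[3]{4}$. Then, for $\alpha\in\{a,b\}$, these objects are well defined: $\phi^-(\cdot\,;\alpha)$ is a well-defined function on $(v_1^0(\alpha),v^-(\alpha))$ with $v^-(\alpha)\ge0$ and $\phi^-(v;\alpha)\to\phi^-(0;\alpha)$ as $v\to0^-$, and $\phi^+(\cdot\,;\alpha)$ is a well-defined function on $(v^+(\alpha),v_3^0(\alpha))$ with $v^+(\alpha)<0$. Moreover: 1. For every $v\in(v_1^0(a),0]$, $\phi^-(v;a)\le\phi^-(v;b)$, with equality if and only if $v=v^-(b)=0$. Here $v^-(b)=0$ is equivalent to $\phi^-(0;b)=0$. 2. For every $v\in[0,v_3^0(b))$, $\phi^+(v;a)>\phi^+(v;b)$.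 -/

import Mathlib

open Set Filter Topology

noncomputable section

namespace RotatedSystem

/-- The cubic `f(v, α) = v³ - α v² - 1`. -/
def f (v α : ℝ) : ℝ := v ^ 3 - α * v ^ 2 - 1

/-- The planar vector field `(v, z) ↦ (v f(v, α) + z², z f(v, α))`. -/
def field (α : ℝ) (p : ℝ × ℝ) : ℝ × ℝ :=
  (p.1 * f p.1 α + p.2 ^ 2, p.2 * f p.1 α)

/-- `γ` restricted to the time set `J` is a solution of the system with parameter `α`
(one-sided derivatives at end points of `J`). -/
def IsSolutionOn (α : ℝ) (γ : ℝ → ℝ × ℝ) (J : Set ℝ) : Prop :=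
  IsIntegralCurveOn γ (fun _ => field α) J

/-- The smallest real root of `f(·, α)`. -/
def v₁ (α : ℝ) : ℝ := sInf {v | f v α = 0}

/-- The second real root of `f(·, α)` in ascending order. -/
def v₂ (α : ℝ) : ℝ := sInf {v | f v α = 0 ∧ v₁ α < v}

/-- The largest real root of `f(·, α)`. -/
def v₃ (α : ℝ) : ℝ := sSup {v | f v α = 0}

/-- The part of `{z > 0, v f(v, α) + z² > 0}` over `v₁ < v < v₂`. -/
def D₂ (α : ℝ) : Set (ℝ × ℝ) :=
  {p | 0 < p.2 ∧ v₁ α < p.1 ∧ p.1 < v₂ α ∧ 0 < p.1 * f p.1 α + p.2 ^ 2}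

/-- The part of `{z > 0, v f(v, α) + z² > 0}` over `v₂ ≤ v < v₃`. -/
def D₃ (α : ℝ) : Set (ℝ × ℝ) :=
  {p | 0 < p.2 ∧ v₂ α ≤ p.1 ∧ p.1 < v₃ α ∧ 0 < p.1 * f p.1 α + p.2 ^ 2}

/-- The unstable separatrix of `P₁ = (v₁, 0)` in the open upper half plane: the points there
whose backward trajectory exists for all negative times and tends to `P₁`. -/
def LMinus (α : ℝ) : Set (ℝ × ℝ) :=
  {p | 0 < p.2 ∧ ∃ γ : ℝ → ℝ × ℝ, γ 0 = p ∧ IsSolutionOn α γ (Iic 0) ∧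
    Tendsto γ atBot (𝓝 (v₁ α, 0))}

/-- The stable separatrix of `P₃ = (v₃, 0)` in the open upper half plane: the points there
whose forward trajectory exists for all positive times and tends to `P₃`. -/
def LPlus (α : ℝ) : Set (ℝ × ℝ) :=
  {p | 0 < p.2 ∧ ∃ γ : ℝ → ℝ × ℝ, γ 0 = p ∧ IsSolutionOn α γ (Ici 0) ∧
    Tendsto γ atTop (𝓝 (v₃ α, 0))}

/-- The maximal arc through `p`, in both time directions, of the trajectory of `p` along which
`dv/dτ = v f(v, α) + z²` stays positive. -/
def arc (α : ℝ) (p : ℝ × ℝ) : Set (ℝ × ℝ) :=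
  {q | ∃ (T : ℝ) (γ : ℝ → ℝ × ℝ), γ 0 = p ∧ γ T = q ∧ IsSolutionOn α γ (uIcc 0 T) ∧
    ∀ τ ∈ uIcc 0 T, 0 < (γ τ).1 * f (γ τ).1 α + (γ τ).2 ^ 2}

/-- The arc of `L⁻(α)` through its points in `D₂` (it does not depend on the point). -/
def arcMinus (α : ℝ) : Set (ℝ × ℝ) := ⋃ p ∈ LMinus α ∩ D₂ α, arc α p

/-- The arc of `L⁺(α)` through its points in `D₃` (it does not depend on the point). -/
def arcPlus (α : ℝ) : Set (ℝ × ℝ) := ⋃ p ∈ LPlus α ∩ D₃ α, arc α p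

/-- `v⁻(α)`, the limit of `v` at the forward end of the arc; as `v` increases along the arc,
this is a supremum, possibly `+∞`. -/
def vMinus (α : ℝ) : EReal := ⨆ p ∈ arcMinus α, (p.1 : EReal)

/-- `v⁺(α)`, the limit of `v` at the backward end of the arc; as `v` increases along the arc,
this is an infimum, possibly `-∞`. -/
def vPlus (α : ℝ) : EReal := ⨅ p ∈ arcPlus α, (p.1 : EReal)

/-- The height `z` of a point `(v, z)` of `S` over `v`; meaningful where it exists uniquely. -/
def height (S : Set (ℝ × ℝ)) (v : ℝ) : ℝ := Classical.epsilon fun z => (v, z) ∈ S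

open Classical in
/-- `φ⁻(v; α)`: the height of the arc of `L⁻(α)` over `v < v⁻(α)`, and its limit from the left
at the end point (used only for `φ⁻(0; α)` when `v⁻(α) = 0`). -/
def phiMinus (v α : ℝ) : ℝ :=
  if (v : EReal) < vMinus α then height (arcMinus α) v
  else limUnder (𝓝[<] v) (height (arcMinus α))

/-- `φ⁺(v; α)`: the height of the arc of `L⁺(α)` over `v`. -/
def phiPlus (v α : ℝ) : ℝ := height (arcPlus α) v

end RotatedSystem

end

/-!
The saddles `P₁` and `P₃` are semi-hyperbolic: the linearization vanishes in the `z`-direction. Two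
observations make them tractable.

**Normal form.** The reflection `w = -v` with time reversal turns the unstable separatrix of `P₁`
into a stable one; for `P₃` put `w = v`. In both cases the system reads `w' = w g(w) + z²`,
`z' = z g(w)` with a cubic `g(w) = w³ + A w² + C` (`cubic A C`; `(A, C) = (α, 1)` for `P₁` and
`(-α, -1)` for `P₃`), and the saddle is `(ρ, 0)` with `ρ > 0` the largest root of `g`, which is
simple (`IsSaddleRoot`).

**Polar variable.** The ratio `x = w / z` satisfies `x' = z`, so in `z > 0` the trajectories are
graphs `z = Z(x)` of solutions of the scalar equation `Z' = g(x Z)`, which is regular at `z = 0` and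
at `x = 0`. The separatrix is the solution with `x Z(x) → ρ` as `x → ∞`. It exists as a limit of
solutions with `n Z n(n) = ρ`, because `g` increases near `ρ`
(`IsSaddleRoot.exists_solution_near`), and it continues down to a point `x₀ ≥ 0` where `w = x Z(x)`
vanishes (`IsSaddleRoot.exists_isSeparatrix`): either `x₀ = 0`, and the `z`-axis is crossed at
height `Z 0 > 0`, or `Z x₀ = 0`, and the trajectory tends to the origin. For `P₁` this
dichotomy is `v⁻ > 0` versus `v⁻ = 0`; for `P₃` only the first case occurs
(`IsSeparatrix.end_pos_of_neg`). By the same monotonicity of `g`, every trajectory tending to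
`(ρ, 0)` in `z > 0` eventually runs along the graph of `Z` (`IsStableOrbit.eventually_on_separatrix`),
which gives uniqueness of the heights (`stableArc_height_unique`). On the separatrix `w' > 0` holds
wherever `w ≥ 0` (`IsStableOrbit.speed_pos_zero`).

**Comparison.** `g` increases with `A` for `w ≠ 0`. Hence, when `A` increases, the saddle root
decreases, and the difference `D` of the old and the new graph satisfies `dD/dx ≤ c(x) D`, with
`D > 0` for large `x`; so `D > 0` wherever both are defined (`IsSeparatrix.lt_of_lt`). As `x Z(x)`
increases, the order persists at equal `w` (`IsSeparatrix.height_lt_height`), and at `w = 0`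
equality is possible only if both curves end at the origin (`IsSeparatrix.end_lt_end`,
`IsSeparatrix.end_eq_zero`).
-/

noncomputable section

namespace RotatedSystem

/-! ### Barrier arguments for scalar functions -/

theorem hasDerivWithinAt_Ici_of_Icc {y : ℝ → ℝ} {c a b x : ℝ}
    (h : HasDerivWithinAt y c (Icc a b) x) (hx : x ∈ Ico a b) :
    HasDerivWithinAt y c (Ici x) x :=
  h.mono_of_mem_nhdsWithin (Icc_mem_nhdsGE_of_mem hx)

/-- A function whose zeros are all strict up-crossings cannot leave `[0, ∞)` forwards. -/
theorem nonneg_of_deriv_pos_at_zeros {y y' : ℝ → ℝ} {a b : ℝ}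
    (hy : ∀ x ∈ Icc a b, HasDerivWithinAt y (y' x) (Icc a b) x) (ha : 0 ≤ y a)
    (h0 : ∀ x ∈ Icc a b, y x = 0 → 0 < y' x) : ∀ x ∈ Icc a b, 0 ≤ y x := by
  intro x hx
  have := image_le_of_deriv_right_lt_deriv_boundary (f := fun x => -y x) (f' := fun x => -y' x)
    (a := a) (b := b) (B := fun _ => 0) (B' := fun _ => 0)
    (fun x hx => (hy x hx).continuousWithinAt.neg)
    (fun x hx => (hasDerivWithinAt_Ici_of_Icc (hy x (Ico_subset_Icc_self hx)) hx).neg)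
    (by simpa using ha) (fun x => hasDerivAt_const x 0)
    (fun x hx h => by
      have := h0 x (Ico_subset_Icc_self hx) (by simpa using h)
      simpa using this) hx
  simpa using this

theorem hasDerivWithinAt_comp_neg {y y' : ℝ → ℝ} {a b : ℝ}
    (hy : ∀ x ∈ Icc a b, HasDerivWithinAt y (y' x) (Icc a b) x) :
    ∀ x ∈ Icc (-b) (-a), HasDerivWithinAt (fun x => y (-x)) (-y' (-x)) (Icc (-b) (-a)) x := by
  intro x hx
  have hm : -x ∈ Icc a b := ⟨by linarith [hx.2], by linarith [hx.1]⟩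
  have := (hy (-x) hm).scomp x (t' := Icc a b) (s := Icc (-b) (-a)) (h := fun x => -x)
    ((hasDerivAt_id x).neg.hasDerivWithinAt) (fun t ht => ⟨by linarith [ht.2], by linarith [ht.1]⟩)
  simpa [Function.comp_def] using this

/-- A function whose zeros are all strict down-crossings cannot leave `[0, ∞)` backwards. -/
theorem nonneg_of_deriv_neg_at_zeros {y y' : ℝ → ℝ} {a b : ℝ}
    (hy : ∀ x ∈ Icc a b, HasDerivWithinAt y (y' x) (Icc a b) x) (hb : 0 ≤ y b)
    (h0 : ∀ x ∈ Icc a b, y x = 0 → y' x < 0) : ∀ x ∈ Icc a b, 0 ≤ y x := by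
  intro x hx
  have := nonneg_of_deriv_pos_at_zeros (hasDerivWithinAt_comp_neg hy) (by simpa using hb)
    (fun x hx h => by
      have := h0 (-x) ⟨by linarith [hx.2], by linarith [hx.1]⟩ h
      linarith) (-x) ⟨by linarith [hx.2], by linarith [hx.1]⟩
  simpa using this

/-- A one-sided Grönwall inequality: `y' ≥ -K y` where `y > 0` keeps `y` positive.
Nothing is assumed where `y ≤ 0`. -/
theorem pos_of_deriv_ge {y y' : ℝ → ℝ} {a b K : ℝ}
    (hy : ∀ x ∈ Icc a b, HasDerivWithinAt y (y' x) (Icc a b) x) (ha : 0 < y a)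
    (h0 : ∀ x ∈ Icc a b, 0 < y x → -K * y x ≤ y' x) : ∀ x ∈ Icc a b, 0 < y x := by
  intro x hx
  have := image_le_of_deriv_right_lt_deriv_boundary (f := fun x => -y x) (f' := fun x => -y' x)
    (a := a) (b := b) (B := fun x => -(y a / 2) * Real.exp (-(K + 1) * (x - a)))
    (B' := fun x => -(y a / 2) * (Real.exp (-(K + 1) * (x - a)) * (-(K + 1) * 1)))
    (fun x hx => (hy x hx).continuousWithinAt.neg)
    (fun x hx => (hasDerivWithinAt_Ici_of_Icc (hy x (Ico_subset_Icc_self hx)) hx).neg)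
    (by simp; linarith)
    (fun x => ((((hasDerivAt_id x).sub_const a).const_mul _).exp).const_mul _)
    (fun x hx h => by
      have he := Real.exp_pos (-(K + 1) * (x - a))
      have hpos : 0 < y x := by
        have : 0 < y a / 2 * Real.exp (-(K + 1) * (x - a)) := by positivity
        linarith
      have h1 := h0 x (Ico_subset_Icc_self hx) hpos
      have h2 : -(y a / 2) * (Real.exp (-(K + 1) * (x - a)) * (-(K + 1) * 1)) = (K + 1) * y x := by
        linear_combination (K + 1) * h
      rw [h2]
      linarith) hx
  have he : 0 < y a / 2 * Real.exp (-(K + 1) * (x - a)) := by positivity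
  linarith

/-- The time reversal of `pos_of_deriv_ge`. -/
theorem pos_of_deriv_le {y y' : ℝ → ℝ} {a b K : ℝ}
    (hy : ∀ x ∈ Icc a b, HasDerivWithinAt y (y' x) (Icc a b) x) (hb : 0 < y b)
    (h0 : ∀ x ∈ Icc a b, 0 < y x → y' x ≤ K * y x) : ∀ x ∈ Icc a b, 0 < y x := by
  intro x hx
  have := pos_of_deriv_ge (K := K) (hasDerivWithinAt_comp_neg hy) (by simpa using hb)
    (fun x hx h => by
      have := h0 (-x) ⟨by linarith [hx.2], by linarith [hx.1]⟩ h
      linarith) (-x) ⟨by linarith [hx.2], by linarith [hx.1]⟩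
  simpa using this

/-! ### The equation `Z' = k(x Z)` with a bounded Lipschitz right-hand side -/

open scoped NNReal in
/-- The boundedness of `k` lets Picard–Lindelöf give a solution on all of `[a, b]`: the ball on
which it is applied may be taken as large as the length of the interval requires. -/
theorem exists_solution_of_bounded_lipschitz {k : ℝ → ℝ} {K B : ℝ≥0} (hk : LipschitzWith K k)
    (hB : ∀ w, |k w| ≤ B) {a b t₀ : ℝ} (ht : t₀ ∈ Icc a b) (z₀ : ℝ) :
    ∃ Z : ℝ → ℝ, Z t₀ = z₀ ∧ ∀ x ∈ Icc a b, HasDerivWithinAt Z (k (x * Z x)) (Icc a b) x := by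
  set M : ℝ≥0 := ⟨max |a| |b|, by positivity⟩ with hM
  set R : ℝ≥0 := B * ⟨max (b - t₀) (t₀ - a), le_max_of_le_left (by linarith [ht.2])⟩ with hR
  have hxM : ∀ x ∈ Icc a b, |x| ≤ M := fun x hx => abs_le_max_abs_abs hx.1 hx.2
  have hp : IsPicardLindelof (fun x z => k (x * z)) (⟨t₀, ht⟩ : Icc a b) z₀ R 0 B (K * M) := by
    refine ⟨fun x hx => ?_, fun z _ => ?_, fun x _ z _ => ?_, ?_⟩
    · refine LipschitzOnWith.of_dist_le_mul fun z _ z' _ => ?_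
      refine (hk.dist_le_mul _ _).trans ?_
      rw [Real.dist_eq, Real.dist_eq, ← mul_sub, abs_mul, NNReal.coe_mul, mul_assoc]
      gcongr
      exact hxM x hx
    · exact (hk.continuous.comp (by fun_prop)).continuousOn
    · exact hB _
    · simp only [hR, NNReal.coe_zero, sub_zero]
      exact le_of_eq rfl
  obtain ⟨Z, h0, h1⟩ := hp.exists_eq_forall_mem_Icc_hasDerivWithinAt₀
  exact ⟨Z, h0, h1⟩

/-- The cubic `g(w) = w³ + A w² + C`. -/
def cubic (A C w : ℝ) : ℝ := w ^ 3 + A * w ^ 2 + C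

/-- The divided difference of `cubic A C`. -/
def cubicDiff (A p q : ℝ) : ℝ := p ^ 2 + p * q + q ^ 2 + A * (p + q)

theorem cubic_sub (A C p q : ℝ) : cubic A C p - cubic A C q = cubicDiff A p q * (p - q) := by
  unfold cubic cubicDiff; ring

@[fun_prop]
theorem continuous_cubic (A C : ℝ) : Continuous (cubic A C) := by
  unfold cubic; fun_prop

theorem hasDerivAt_cubic (A C w : ℝ) : HasDerivAt (cubic A C) (3 * w ^ 2 + 2 * A * w) w := by
  unfold cubic
  have := (((hasDerivAt_id w).pow 3).add (((hasDerivAt_id w).pow 2).const_mul A)).add_const C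
  refine this.congr_deriv ?_
  simp; ring

/-- Truncation of `w` to `[lo, hi]`. -/
def clamp (lo hi w : ℝ) : ℝ := max lo (min hi w)

theorem clamp_mem {lo hi : ℝ} (h : lo ≤ hi) (w : ℝ) : clamp lo hi w ∈ Icc lo hi :=
  ⟨le_max_left _ _, max_le h (min_le_left _ _)⟩

theorem clamp_of_mem {lo hi w : ℝ} (h : w ∈ Icc lo hi) : clamp lo hi w = w := by
  unfold clamp; rw [min_eq_right h.2, max_eq_right h.1]

theorem clamp_mono (lo hi : ℝ) : Monotone (clamp lo hi) := fun _ _ h =>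
  max_le_max le_rfl (min_le_min le_rfl h)

theorem abs_clamp_sub_le (lo hi p q : ℝ) : |clamp lo hi p - clamp lo hi q| ≤ |p - q| := by
  unfold clamp
  rw [max_comm lo, max_comm lo, min_comm hi, min_comm hi]
  refine (abs_max_sub_max_le_abs _ _ _).trans ?_
  rcases le_total p q with h | h
  · rw [abs_le, abs_sub_comm, abs_of_nonneg (sub_nonneg.2 h)]
    constructor <;> cases min_cases p hi <;> cases min_cases q hi <;> linarith
  · rw [abs_le, abs_of_nonneg (sub_nonneg.2 h)]
    constructor <;> cases min_cases p hi <;> cases min_cases q hi <;> linarith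

open scoped NNReal in
theorem exists_lipschitz_cubic_clamp (A C : ℝ) {lo hi : ℝ} (h : lo ≤ hi) :
    ∃ K B : ℝ≥0, LipschitzWith K (fun w => cubic A C (clamp lo hi w)) ∧
      ∀ w, |cubic A C (clamp lo hi w)| ≤ B := by
  have hcomp : IsCompact (Icc lo hi ×ˢ Icc lo hi) := isCompact_Icc.prod isCompact_Icc
  obtain ⟨K, hK⟩ := hcomp.exists_bound_of_continuousOn
    (f := fun p : ℝ × ℝ => cubicDiff A p.1 p.2) (by unfold cubicDiff; fun_prop)
  obtain ⟨B, hB⟩ := (isCompact_Icc : IsCompact (Icc lo hi)).exists_bound_of_continuousOn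
    (continuous_cubic A C).continuousOn
  refine ⟨K.toNNReal, B.toNNReal, LipschitzWith.of_dist_le_mul fun p q => ?_, fun w => ?_⟩
  · rw [Real.dist_eq, Real.dist_eq, cubic_sub, abs_mul]
    exact mul_le_mul ((hK (clamp lo hi p, clamp lo hi q) ⟨clamp_mem h p, clamp_mem h q⟩).trans
        (Real.le_coe_toNNReal K)) (abs_clamp_sub_le _ _ _ _) (abs_nonneg _) (NNReal.coe_nonneg _)
  · exact (hB _ (clamp_mem h w)).trans (Real.le_coe_toNNReal B)

/-! ### The separatrix near its saddle -/

/-- `ρ` is the largest root of `cubic A C`, it is positive and simple. Then `(ρ, 0)` is a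
semi-hyperbolic saddle of `w' = w g(w) + z²`, `z' = z g(w)`. -/
structure IsSaddleRoot (A C ρ : ℝ) : Prop where
  pos : 0 < ρ
  root : cubic A C ρ = 0
  slope : 0 < 3 * ρ ^ 2 + 2 * A * ρ
  largest : ∀ w, ρ < w → 0 < cubic A C w

namespace IsSaddleRoot

variable {A C ρ : ℝ}

/-- `g` increases strictly near `ρ`. -/
theorem exists_cubicDiff_pos (h : IsSaddleRoot A C ρ) :
    ∃ δ, 0 < δ ∧ δ < ρ ∧ ∀ p ∈ Icc (ρ - δ) (ρ + δ), ∀ q ∈ Icc (ρ - δ) (ρ + δ),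
      0 < cubicDiff A p q := by
  have hc : Continuous fun p : ℝ × ℝ => cubicDiff A p.1 p.2 := by unfold cubicDiff; fun_prop
  have h0 : 0 < cubicDiff A ρ ρ := by
    have := h.slope
    unfold cubicDiff; linarith
  have hev := (hc.tendsto (ρ, ρ)).eventually_const_lt h0
  obtain ⟨ε, hε, hb⟩ := Metric.eventually_nhds_iff.1 hev
  refine ⟨min (ε / 2) (ρ / 2), by have := h.pos; positivity,
    (min_le_right _ _).trans_lt (by linarith [h.pos]), fun p hp q hq => hb (y := (p, q)) ?_⟩
  have h1 := min_le_left (ε / 2) (ρ / 2)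
  rw [Prod.dist_eq, max_lt_iff, Real.dist_eq, Real.dist_eq, abs_lt, abs_lt]
  refine ⟨⟨?_, ?_⟩, ?_, ?_⟩ <;> simp only <;> linarith [hp.1, hp.2, hq.1, hq.2]

/-- Solutions of the truncated equation that start on `x Z = ρ` stay, backwards, in a thin strip
`ρ - ε ≤ x Z ≤ ρ` as long as `x` is large. -/
theorem strip (h : IsSaddleRoot A C ρ) {δ ε X N : ℝ} {Z : ℝ → ℝ} (hε : 0 < ε) (hεδ : ε ≤ δ)
    (hX : 0 < X) (hbar : ∀ x ≥ X, (ρ - ε) / x + x * cubic A C (ρ - ε) < 0)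
    (hN : N * Z N = ρ)
    (hZ : ∀ x ∈ Icc X N, HasDerivAt Z (cubic A C (clamp (ρ - δ) ρ (x * Z x))) x) :
    ∀ x ∈ Icc X N, x * Z x ∈ Icc (ρ - ε) ρ := by
  have hw : ∀ x ∈ Icc X N, HasDerivWithinAt (fun x => x * Z x)
      (Z x + x * cubic A C (clamp (ρ - δ) ρ (x * Z x))) (Icc X N) x := fun x hx => by
    simpa using ((hasDerivAt_id' x).fun_mul (hZ x hx)).hasDerivWithinAt
  intro x hx
  constructor
  · have := nonneg_of_deriv_neg_at_zeros (fun x hx => (hw x hx).sub_const (ρ - ε))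
      (by linarith) (fun t ht h0 => by
        have ht0 : 0 < t := hX.trans_le ht.1
        have h1 : t * Z t = ρ - ε := by linarith
        have h2 : Z t = (ρ - ε) / t := by field_simp; linarith
        rw [h1, clamp_of_mem ⟨by linarith, by linarith⟩, h2]
        exact hbar t ht.1) x hx
    linarith
  · have := nonneg_of_deriv_neg_at_zeros (fun x hx => (hw x hx).const_sub ρ)
      (by linarith) (fun t ht h0 => by
        have ht0 : 0 < t := hX.trans_le ht.1
        have h1 : t * Z t = ρ := by linarith
        have h2 : 0 < Z t := by
          have : Z t = ρ / t := by field_simp; linarith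
          rw [this]; exact div_pos h.pos ht0
        rw [h1, clamp_of_mem ⟨by linarith, le_rfl⟩, h.root]
        linarith) x hx
    linarith

/-- The lower edge `x Z = ρ - ε` of the strip is crossed only downwards once `x` is large. -/
theorem exists_barrier {ε : ℝ} (hε : 0 < ε) (hερ : ε < ρ)
    (hneg : cubic A C (ρ - ε) < 0) :
    ∃ X, 0 < X ∧ ∀ x ≥ X, (ρ - ε) / x + x * cubic A C (ρ - ε) < 0 := by
  set c := -cubic A C (ρ - ε) with hc
  have hc0 : 0 < c := by linarith
  refine ⟨max 1 (ρ / c), by positivity, fun x hx => ?_⟩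
  have h1 : 1 ≤ x := (le_max_left _ _).trans hx
  have h2 : ρ / c ≤ x := (le_max_right _ _).trans hx
  have h3 : ρ ≤ x * c := by rwa [div_le_iff₀ hc0] at h2
  have h4 : (ρ - ε) / x ≤ ρ - ε := div_le_self (by linarith) h1
  have : cubic A C (ρ - ε) = -c := by linarith
  rw [this]; linarith

/-- The separatrix of the saddle near the saddle, as a solution of `Z' = g(x Z)` on a half-line.
It is the limit of the solutions `Z n` with `n Z n(n) = ρ`; since `g` increases near `ρ`, the
distances `|Z n - Z m|`, `n ≤ m`, increase in `x`, so they are at most the distance `O(1 / n)` at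
`x = n`. -/
theorem exists_solution_near (h : IsSaddleRoot A C ρ) :
    ∃ X > 0, ∃ Z : ℝ → ℝ, (∀ x ≥ X, HasDerivAt Z (cubic A C (x * Z x)) x) ∧
      (∀ x ≥ X, 0 < x * Z x ∧ x * Z x ≤ ρ) ∧ Tendsto (fun x => x * Z x) atTop (𝓝 ρ) := by
  obtain ⟨δ, hδ, hδρ, hD⟩ := h.exists_cubicDiff_pos
  have hρ := h.pos
  have hmono : MonotoneOn (cubic A C) (Icc (ρ - δ) ρ) := fun p hp q hq hpq => by
    have h1 := hD q ⟨hq.1, by linarith [hq.2]⟩ p ⟨hp.1, by linarith [hp.2]⟩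
    have h2 := cubic_sub A C q p
    nlinarith
  have hneg : ∀ ε, 0 < ε → ε ≤ δ → cubic A C (ρ - ε) < 0 := fun ε h1 h2 => by
    have h3 := hD (ρ - ε) ⟨by linarith, by linarith⟩ ρ ⟨by linarith, by linarith⟩
    have h4 := cubic_sub A C (ρ - ε) ρ
    rw [h.root] at h4
    nlinarith
  have hlo : ρ - δ ≤ ρ := by linarith
  obtain ⟨K, B, hK, hB⟩ := exists_lipschitz_cubic_clamp A C hlo
  set k : ℝ → ℝ := fun w => cubic A C (clamp (ρ - δ) ρ w) with hk
  have hkmono : Monotone k := fun p q hpq =>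
    hmono (clamp_mem hlo p) (clamp_mem hlo q) (clamp_mono _ _ hpq)
  have hex : ∀ n : ℕ, ∃ Z : ℝ → ℝ, Z n = ρ / n ∧
      ∀ x ∈ Icc (0 : ℝ) (n + 1), HasDerivWithinAt Z (k (x * Z x)) (Icc 0 (n + 1)) x := fun n =>
    exists_solution_of_bounded_lipschitz hK hB (a := 0) (b := n + 1) (t₀ := n)
      ⟨by positivity, by linarith⟩ _
  choose Z hZn hZd using hex
  have hZ : ∀ n : ℕ, ∀ x : ℝ, 0 < x → x < n + 1 → HasDerivAt (Z n) (k (x * Z n x)) x :=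
    fun n x h1 h2 => (hZd n x ⟨h1.le, h2.le⟩).hasDerivAt (Icc_mem_nhds h1 h2)
  have hstart : ∀ n : ℕ, (0 : ℝ) < n → n * Z n n = ρ := fun n hn => by
    rw [hZn]; field_simp
  have hstrip : ∀ ε, 0 < ε → ε ≤ δ → ∃ X : ℝ, 0 < X ∧ ∀ n : ℕ, ∀ x : ℝ, X ≤ x → x ≤ n →
      x * Z n x ∈ Icc (ρ - ε) ρ := fun ε h1 h2 => by
    obtain ⟨X, hX, hbar⟩ := exists_barrier h1 (h2.trans_lt hδρ) (hneg ε h1 h2)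
    refine ⟨X, hX, fun n x hx hxn => ?_⟩
    exact h.strip h1 h2 hX hbar (hstart n (hX.trans_le (hx.trans hxn)))
      (fun t ht => hZ n t (hX.trans_le ht.1) (by linarith [ht.2])) x ⟨hx, hxn⟩
  obtain ⟨X, hX, hXs⟩ := hstrip δ hδ le_rfl
  -- distances between the approximants are controlled by their value at the smaller start
  have hdist : ∀ n m : ℕ, n ≤ m → ∀ x : ℝ, X ≤ x → x ≤ n → |Z n x - Z m x| ≤ δ / n := by
    intro n m hnm x hx hxn
    have hnm' : (n : ℝ) ≤ m := by exact_mod_cast hnm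
    have hn0 : (0 : ℝ) < n := hX.trans_le (hx.trans hxn)
    have hd : ∀ t ∈ Icc X n, HasDerivAt (fun t => (Z n t - Z m t) ^ 2)
        (2 * (Z n t - Z m t) * (k (t * Z n t) - k (t * Z m t))) t := fun t ht => by
      have h1 := hZ n t (hX.trans_le ht.1) (by linarith [ht.2])
      have h2 := hZ m t (hX.trans_le ht.1) (by linarith [ht.2])
      simpa using (h1.fun_sub h2).fun_pow 2
    have hmon : MonotoneOn (fun t => (Z n t - Z m t) ^ 2) (Icc X n) := by
      refine monotoneOn_of_deriv_nonneg (convex_Icc _ _)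
        (fun t ht => (hd t ht).continuousAt.continuousWithinAt)
        (fun t ht => (hd t (interior_subset ht)).differentiableAt.differentiableWithinAt)
        fun t ht => ?_
      have ht := interior_subset ht
      rw [(hd t ht).deriv]
      have ht0 : 0 < t := hX.trans_le ht.1
      rcases le_total (Z n t) (Z m t) with hle | hle
      · have := hkmono (mul_le_mul_of_nonneg_left hle ht0.le)
        nlinarith
      · have := hkmono (mul_le_mul_of_nonneg_left hle ht0.le)
        have h3 : 0 ≤ Z n t - Z m t := by linarith
        have h4 : 0 ≤ k (t * Z n t) - k (t * Z m t) := by linarith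
        positivity
    have h1 := hmon ⟨hx, hxn⟩ (right_mem_Icc.2 (hx.trans hxn)) hxn
    have h2 := sq_le_sq.1 h1
    refine h2.trans ?_
    have h3 := hXs m n (hx.trans hxn) hnm'
    have h4 : (n : ℝ) * |Z n n - Z m n| ≤ δ := by
      rw [← abs_of_pos hn0, ← abs_mul, abs_of_pos hn0, mul_sub, hstart n hn0, abs_le]
      constructor <;> linarith [h3.1, h3.2]
    rw [le_div_iff₀ hn0]; linarith
  have hlim0 : Tendsto (fun n : ℕ => δ / (n : ℝ)) atTop (𝓝 0) :=
    tendsto_const_div_atTop_nhds_zero_nat δ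
  have hlim : ∀ x : ℝ, X ≤ x → ∃ z, Tendsto (fun n => Z n x) atTop (𝓝 z) := fun x hx => by
    refine cauchySeq_tendsto_of_complete (Metric.cauchySeq_iff'.2 fun ε hε => ?_)
    have h1 := hlim0.eventually_lt_const hε
    have h2 : ∀ᶠ n : ℕ in atTop, x ≤ n := tendsto_natCast_atTop_atTop.eventually_ge_atTop x
    obtain ⟨N, hN1, hN2⟩ := (h1.and h2).exists
    refine ⟨N, fun n hn => ?_⟩
    rw [dist_comm, Real.dist_eq]
    exact (hdist N n hn x hx hN2).trans_lt hN1
  choose! W hW using hlim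
  have hWdist : ∀ n : ℕ, ∀ x : ℝ, X ≤ x → x ≤ n → |Z n x - W x| ≤ δ / n := fun n x hx hxn => by
    refine le_of_tendsto (((hW x hx).const_sub (Z n x)).abs) ?_
    filter_upwards [eventually_ge_atTop n] with m hm using hdist n m hm x hx hxn
  have hWstrip : ∀ ε, 0 < ε → ε ≤ δ → ∃ Y : ℝ, 0 < Y ∧ ∀ x : ℝ, X ≤ x → Y ≤ x →
      x * W x ∈ Icc (ρ - ε) ρ := fun ε h1 h2 => by
    obtain ⟨Y, hY, hYs⟩ := hstrip ε h1 h2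
    refine ⟨Y, hY, fun x hx hx' => isClosed_Icc.mem_of_tendsto ((hW x hx).const_mul x) ?_⟩
    filter_upwards [tendsto_natCast_atTop_atTop.eventually_ge_atTop x] with n hn
    exact hYs n x hx' hn
  have hWX : ∀ x : ℝ, X ≤ x → x * W x ∈ Icc (ρ - δ) ρ := fun x hx => by
    refine isClosed_Icc.mem_of_tendsto ((hW x hx).const_mul x) ?_
    filter_upwards [tendsto_natCast_atTop_atTop.eventually_ge_atTop x] with n hn
    exact hXs n x hx hn
  have hder : ∀ x : ℝ, X < x → HasDerivAt W (cubic A C (x * W x)) x := by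
    intro x hx
    obtain ⟨N, hN⟩ := exists_nat_gt x
    have hxs : x ∈ Ioo X (N : ℝ) := ⟨hx, hN⟩
    have := hasDerivAt_of_tendstoUniformlyOn (l := atTop) (f := Z)
      (f' := fun n y => k (y * Z n y)) (g := W) (g' := fun y => k (y * W y)) isOpen_Ioo
      (s := Ioo X (N : ℝ)) ?_ ?_ (fun y hy => hW y hy.1.le) hxs
    · simp only [hk] at this
      rwa [clamp_of_mem (hWX x hx.le)] at this
    · rw [Metric.tendstoUniformlyOn_iff]
      intro ε hε
      have h1 : Tendsto (fun n : ℕ => K * (N * (δ / (n : ℝ)))) atTop (𝓝 0) := by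
        simpa using (hlim0.const_mul (N : ℝ)).const_mul (K : ℝ)
      filter_upwards [h1.eventually_lt_const hε, eventually_ge_atTop N] with n hn hnN y hy
      have hyn : y ≤ n := hy.2.le.trans (by exact_mod_cast hnN)
      refine ((hK.dist_le_mul _ _).trans ?_).trans_lt hn
      rw [Real.dist_eq, ← mul_sub, abs_mul, abs_sub_comm, abs_of_pos (hX.trans hy.1)]
      have := hWdist n y hy.1.le hyn
      have := hy.2.le
      gcongr
    · filter_upwards [eventually_ge_atTop N] with n hn y hy
      exact hZ n y (hX.trans hy.1) (by
        have : (N : ℝ) ≤ n := by exact_mod_cast hn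
        linarith [hy.2])
  refine ⟨X + 1, by linarith, W, fun x hx => hder x (by linarith), fun x hx => ?_, ?_⟩
  · have := hWX x (by linarith)
    exact ⟨by linarith [this.1], this.2⟩
  · rw [Metric.tendsto_atTop]
    intro ε hε
    obtain ⟨Y, hY, hYs⟩ := hWstrip (min (ε / 2) δ) (by positivity) (min_le_right _ _)
    refine ⟨max X Y, fun x hx => ?_⟩
    have h1 := hYs x ((le_max_left _ _).trans hx) ((le_max_right _ _).trans hx)
    have h2 := min_le_left (ε / 2) δ
    rw [Real.dist_eq, abs_lt]
    constructor <;> linarith [h1.1, h1.2]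

end IsSaddleRoot

/-! ### The separatrix as a global graph over `x = w / z` -/

/-- `Z` describes the stable separatrix of `(ρ, 0)` in `z > 0` as the curve
`x ↦ (w, z) = (x Z(x), Z(x))`, `x > x₀`, where `x₀ ≥ 0` is the place where the curve, followed
backwards, reaches `w = 0`: at a point of the `z`-axis (`x₀ = 0`), or at the origin
(`Z x₀ = 0`). In the former case `Z` continues to negative `x`. -/
structure IsSeparatrix (A C ρ x₀ : ℝ) (Z : ℝ → ℝ) : Prop where
  x₀_nonneg : 0 ≤ x₀
  deriv : ∀ x ≥ x₀, HasDerivAt Z (cubic A C (x * Z x)) x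
  pos : ∀ x > x₀, 0 < Z x
  le : ∀ x > x₀, x * Z x ≤ ρ
  tendsto : Tendsto (fun x => x * Z x) atTop (𝓝 ρ)
  end_nonneg : 0 ≤ Z x₀
  end_mul : x₀ * Z x₀ = 0
  past : 0 < Z x₀ → ∃ ε > 0, ∀ x > -ε, HasDerivAt Z (cubic A C (x * Z x)) x ∧ 0 < Z x

theorem hasDerivAt_ite {Z₁ Z₂ : ℝ → ℝ} {c x : ℝ} (h₁ : HasDerivAt Z₁ c x) (h₂ : HasDerivAt Z₂ c x)
    (h : Z₁ x = Z₂ x) : HasDerivAt (fun t => if t ≤ x then Z₁ t else Z₂ t) c x := by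
  have h3 : HasDerivWithinAt (fun t => if t ≤ x then Z₁ t else Z₂ t) c (Iic x) x :=
    h₁.hasDerivWithinAt.congr (fun t ht => if_pos ht) (if_pos le_rfl)
  have h4 : HasDerivWithinAt (fun t => if t ≤ x then Z₁ t else Z₂ t) c (Ici x) x := by
    refine h₂.hasDerivWithinAt.congr (fun t ht => ?_) ((if_pos le_rfl).trans h)
    rcases (mem_Ici.1 ht).eq_or_lt with rfl | hlt
    · exact (if_pos le_rfl).trans h
    · exact if_neg (not_le.2 hlt)
  have := h3.union h4
  rwa [Iic_union_Ici, hasDerivWithinAt_univ] at this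

/-- The local separatrix is continued to smaller `x` by the equation truncated to `|x Z| ≤ ρ`, up to
the first zero of `Z`. The truncation is inactive there, since on `x Z = ρ` the equation gives
`(x Z)' = Z > 0`, so that the curve stays in `x Z ≤ ρ` backwards. -/
theorem IsSaddleRoot.exists_isSeparatrix {A C ρ : ℝ} (h : IsSaddleRoot A C ρ) :
    ∃ x₀ Z, IsSeparatrix A C ρ x₀ Z := by
  have hρ := h.pos
  obtain ⟨X, hX, Z₁, hd₁, hw₁, ht₁⟩ := h.exists_solution_near
  obtain ⟨K, B, hK, hB⟩ := exists_lipschitz_cubic_clamp A C (show -ρ ≤ ρ by linarith)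
  set k : ℝ → ℝ := fun w => cubic A C (clamp (-ρ) ρ w) with hk
  have hkeq : ∀ w, w ∈ Icc (-ρ) ρ → k w = cubic A C w := fun w hw => by
    simp only [hk]; rw [clamp_of_mem hw]
  set Y := X + 1 with hY
  obtain ⟨Z₂, h20, h2d⟩ := exists_solution_of_bounded_lipschitz hK hB (a := -1) (b := Y + 1)
    (t₀ := Y) ⟨by linarith, by linarith⟩ (Z₁ Y)
  have hd₂ : ∀ x, -1 < x → x < Y + 1 → HasDerivAt Z₂ (k (x * Z₂ x)) x := fun x h1 h2 =>
    (h2d x ⟨h1.le, h2.le⟩).hasDerivAt (Icc_mem_nhds h1 h2)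
  set Z : ℝ → ℝ := fun x => if x ≤ Y then Z₂ x else Z₁ x with hZdef
  have hZY : ∀ x, Y ≤ x → Z x = Z₁ x := fun x hx => by
    rcases hx.eq_or_lt with rfl | hlt
    · rw [hZdef]; simp [h20]
    · rw [hZdef]; simp [hlt]
  have hwY : ∀ x, Y ≤ x → 0 < x * Z x ∧ x * Z x ≤ ρ := fun x hx => by
    rw [hZY x hx]; exact hw₁ x (by linarith)
  have hder : ∀ x, -1 < x → HasDerivAt Z (k (x * Z x)) x := by
    intro x hx
    rcases lt_trichotomy x Y with hlt | rfl | hgt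
    · have hev : Z =ᶠ[𝓝 x] Z₂ := by
        filter_upwards [Iio_mem_nhds hlt] with t ht using if_pos (le_of_lt ht)
      rw [hev.eq_of_nhds]
      exact (hd₂ x hx (by linarith)).congr_of_eventuallyEq hev
    · have h1 := hd₂ Y hx (by linarith)
      have h2 := hd₁ Y (by linarith)
      have h3 := hwY Y le_rfl
      rw [hZY Y le_rfl] at h3 ⊢
      rw [h20] at h1
      rw [← hkeq _ ⟨by linarith [h3.1], h3.2⟩] at h2
      exact hasDerivAt_ite h1 h2 h20
    · have hev : Z =ᶠ[𝓝 x] Z₁ := by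
        filter_upwards [Ioi_mem_nhds hgt] with t ht using if_neg (not_le.2 ht)
      have h3 := hwY x hgt.le
      rw [hkeq _ ⟨by linarith [h3.1], h3.2⟩, hev.eq_of_nhds]
      exact (hd₁ x (by linarith)).congr_of_eventuallyEq hev
  have hcont : ∀ x, -1 < x → ContinuousAt Z x := fun x hx => (hder x hx).continuousAt
  -- the last zero of `Z` before `Y`, or `0` if there is none
  set S : Set ℝ := {0} ∪ (Icc 0 Y ∩ Z ⁻¹' Iic 0) with hS
  have hScomp : IsCompact S := by
    refine isCompact_singleton.union ?_
    refine isCompact_Icc.of_isClosed_subset ?_ inter_subset_left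
    exact ContinuousOn.preimage_isClosed_of_isClosed
      (fun x hx => (hcont x (by linarith [hx.1])).continuousWithinAt) isClosed_Icc isClosed_Iic
  have hmem : sSup S ∈ S := hScomp.sSup_mem ⟨0, Or.inl rfl⟩
  set x₀ := sSup S with hx₀
  have hle : ∀ x ∈ S, x ≤ x₀ := fun x hx => le_csSup hScomp.bddAbove hx
  have hx0 : 0 ≤ x₀ := hle 0 (Or.inl rfl)
  have hpos : ∀ x > x₀, 0 < Z x := by
    intro x hx
    rcases le_or_gt x Y with hxY | hxY
    · by_contra hneg
      have := hle x (Or.inr ⟨⟨hx0.trans hx.le, hxY⟩, not_lt.1 hneg⟩)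
      linarith
    · exact pos_of_mul_pos_right (hwY x hxY.le).1 (by linarith)
  have hwle : ∀ x > x₀, x * Z x ≤ ρ := by
    intro x hx
    rcases le_or_gt x Y with hxY | hxY
    · have := nonneg_of_deriv_neg_at_zeros (a := x) (b := Y) (y := fun t => ρ - t * Z t)
        (y' := fun t => -(Z t + t * k (t * Z t))) (fun t ht => by
          have := ((hasDerivAt_id' t).fun_mul (hder t (by linarith [ht.1]))).const_sub ρ
          simpa using this.hasDerivWithinAt) (by linarith [(hwY Y le_rfl).2]) (fun t ht h0 => by
          have h1 : t * Z t = ρ := by linarith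
          have h2 := hpos t (by linarith [ht.1])
          rw [h1, hkeq ρ ⟨by linarith, le_rfl⟩, h.root]
          linarith) x ⟨le_rfl, hxY⟩
      linarith
    · exact (hwY x hxY.le).2
  have hend : 0 ≤ Z x₀ := by
    refine ge_of_tendsto ((hcont x₀ (by linarith)).tendsto.mono_left nhdsWithin_le_nhds)
      (f := Z) (x := 𝓝[>] x₀) ?_
    filter_upwards [self_mem_nhdsWithin] with x hx using (hpos x hx).le
  have hmul : x₀ * Z x₀ = 0 := by
    rcases hmem with h0 | ⟨-, h0⟩
    · rw [mem_singleton_iff.1 h0]; simp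
    · rw [le_antisymm h0 hend, mul_zero]
  refine ⟨x₀, Z, hx0, fun x hx => ?_, hpos, hwle, ?_, hend, hmul, fun hZ0 => ?_⟩
  · rw [← hkeq]
    · exact hder x (by linarith)
    · rcases (show x₀ ≤ x from hx).eq_or_lt with rfl | hlt
      · rw [hmul]; constructor <;> linarith
      · have := mul_pos (lt_of_le_of_lt hx0 hlt) (hpos x hlt)
        exact ⟨by linarith, hwle x hlt⟩
  · refine ht₁.congr' ?_
    filter_upwards [eventually_ge_atTop Y] with x hx
    rw [hZY x hx]
  · have hx00 : x₀ = 0 := by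
      rcases mul_eq_zero.1 hmul with h0 | h0
      · exact h0
      · linarith
    have hc0 := hcont x₀ (by linarith)
    have hev : ∀ᶠ x in 𝓝 x₀, 0 < Z x ∧ -1 < x ∧ x * Z x ∈ Ioo (-ρ) ρ := by
      refine (hc0.eventually_const_lt hZ0).and ((eventually_gt_nhds (by linarith)).and ?_)
      exact (continuousAt_id.mul hc0).eventually_mem
        (by simpa [hmul] using Ioo_mem_nhds (show -ρ < 0 by linarith) hρ)
    obtain ⟨ε, hε, hb⟩ := Metric.eventually_nhds_iff.1 hev
    refine ⟨ε, hε, fun x hx => ?_⟩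
    rcases le_or_gt x x₀ with hxx | hxx
    · obtain ⟨h1, h2, h3⟩ := hb (y := x) (by rw [Real.dist_eq, abs_lt]; constructor <;> linarith)
      refine ⟨?_, h1⟩
      rw [← hkeq _ (Ioo_subset_Icc_self h3)]
      exact hder x h2
    · refine ⟨?_, hpos x hxx⟩
      rw [← hkeq]
      · exact hder x (by linarith)
      · have := mul_pos (lt_of_le_of_lt hx0 hxx) (hpos x hxx)
        exact ⟨by linarith, hwle x hxx⟩

/-! ### Integral curves of the planar system -/

section General

variable {E : Type*} [NormedAddCommGroup E] [NormedSpace ℝ E] {F : E → E} {γ γ' : ℝ → E}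

theorem isIntegralCurveOn_comp_add_const {J J' : Set ℝ} (c : ℝ)
    (h : IsIntegralCurveOn γ (fun _ => F) J) (hJ : ∀ t ∈ J', t + c ∈ J) :
    IsIntegralCurveOn (fun t => γ (t + c)) (fun _ => F) J' := fun t ht => by
  have := (h (t + c) (hJ t ht)).scomp (h := fun t => t + c) t
    ((hasDerivAt_id' t).add_const c).hasDerivWithinAt hJ
  simpa [Function.comp_def] using this

theorem isIntegralCurveOn_comp_neg {J J' : Set ℝ}
    (h : IsIntegralCurveOn γ (fun _ => F) J) (hJ : ∀ t ∈ J', -t ∈ J) :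
    IsIntegralCurveOn (fun t => γ (-t)) (fun _ p => -F p) J' := fun t ht => by
  have := (h (-t) (hJ t ht)).scomp (h := fun t => -t) t
    ((hasDerivAt_id' t).neg).hasDerivWithinAt hJ
  simpa [Function.comp_def] using this

variable [ProperSpace E]

theorem exists_lipschitz_ball (hF : ContDiff ℝ 1 F) {a b : ℝ}
    (h : IsIntegralCurveOn γ (fun _ => F) (Icc a b))
    (h' : IsIntegralCurveOn γ' (fun _ => F) (Icc a b)) :
    ∃ K R, LipschitzOnWith K F (Metric.closedBall 0 R) ∧
      (∀ t ∈ Icc a b, γ t ∈ Metric.closedBall 0 R) ∧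
      ∀ t ∈ Icc a b, γ' t ∈ Metric.closedBall 0 R := by
  obtain ⟨R, hR⟩ := isCompact_Icc.exists_bound_of_continuousOn h.continuousOn
  obtain ⟨R', hR'⟩ := isCompact_Icc.exists_bound_of_continuousOn h'.continuousOn
  have hFb := hF.contDiffOn (s := Metric.closedBall (0 : E) (max R R'))
  obtain ⟨K, hK⟩ := hFb.exists_lipschitzOnWith one_ne_zero (convex_closedBall _ _)
    (isCompact_closedBall _ _)
  refine ⟨K, max R R', hK, fun t ht => ?_, fun t ht => ?_⟩
  · simpa using Or.inl (hR t ht)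
  · simpa using Or.inr (hR' t ht)

theorem eqOn_of_eq_left (hF : ContDiff ℝ 1 F) {a b : ℝ}
    (h : IsIntegralCurveOn γ (fun _ => F) (Icc a b))
    (h' : IsIntegralCurveOn γ' (fun _ => F) (Icc a b)) (heq : γ a = γ' a) :
    EqOn γ γ' (Icc a b) := by
  obtain ⟨K, R, hK, h1, h2⟩ := exists_lipschitz_ball hF h h'
  exact ODE_solution_unique_of_mem_Icc_right (v := fun _ => F) (s := fun _ => Metric.closedBall 0 R)
    (fun _ _ => hK) h.continuousOn
    (fun t ht => (h t (Ico_subset_Icc_self ht)).mono_of_mem_nhdsWithin (Icc_mem_nhdsGE_of_mem ht))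
    (fun t ht => h1 t (Ico_subset_Icc_self ht)) h'.continuousOn
    (fun t ht => (h' t (Ico_subset_Icc_self ht)).mono_of_mem_nhdsWithin (Icc_mem_nhdsGE_of_mem ht))
    (fun t ht => h2 t (Ico_subset_Icc_self ht)) heq

theorem eqOn_of_eq_right (hF : ContDiff ℝ 1 F) {a b : ℝ}
    (h : IsIntegralCurveOn γ (fun _ => F) (Icc a b))
    (h' : IsIntegralCurveOn γ' (fun _ => F) (Icc a b)) (heq : γ b = γ' b) :
    EqOn γ γ' (Icc a b) := by
  obtain ⟨K, R, hK, h1, h2⟩ := exists_lipschitz_ball hF h h'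
  exact ODE_solution_unique_of_mem_Icc_left (v := fun _ => F) (s := fun _ => Metric.closedBall 0 R)
    (fun _ _ => hK) h.continuousOn
    (fun t ht => (h t (Ioc_subset_Icc_self ht)).mono_of_mem_nhdsWithin (Icc_mem_nhdsLE_of_mem ht))
    (fun t ht => h1 t (Ioc_subset_Icc_self ht)) h'.continuousOn
    (fun t ht => (h' t (Ioc_subset_Icc_self ht)).mono_of_mem_nhdsWithin (Icc_mem_nhdsLE_of_mem ht))
    (fun t ht => h2 t (Ioc_subset_Icc_self ht)) heq

end General

/-- `w' = w g(w) + z²`. -/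
def speed (A C : ℝ) (p : ℝ × ℝ) : ℝ := p.1 * cubic A C p.1 + p.2 ^ 2

/-- The vector field `(w, z) ↦ (w g(w) + z², z g(w))` with `g = cubic A C`. -/
def planar (A C : ℝ) (p : ℝ × ℝ) : ℝ × ℝ := (speed A C p, p.2 * cubic A C p.1)

theorem contDiff_planar (A C : ℝ) : ContDiff ℝ 1 (planar A C) := by
  unfold planar speed cubic; fun_prop

section Planar

variable {A C : ℝ} {γ : ℝ → ℝ × ℝ} {J : Set ℝ}

theorem hasDerivWithinAt_fst (h : IsIntegralCurveOn γ (fun _ => planar A C) J) :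
    ∀ t ∈ J, HasDerivWithinAt (fun t => (γ t).1) (speed A C (γ t)) J t := fun t ht =>
  (hasFDerivAt_fst (𝕜 := ℝ) (p := γ t)).comp_hasDerivWithinAt t (h t ht)

theorem hasDerivWithinAt_snd (h : IsIntegralCurveOn γ (fun _ => planar A C) J) :
    ∀ t ∈ J, HasDerivWithinAt (fun t => (γ t).2) ((γ t).2 * cubic A C (γ t).1) J t := fun t ht =>
  (hasFDerivAt_snd (𝕜 := ℝ) (p := γ t)).comp_hasDerivWithinAt t (h t ht)

theorem hasDerivWithinAt_speed (h : IsIntegralCurveOn γ (fun _ => planar A C) J) :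
    ∀ t ∈ J, HasDerivWithinAt (fun t => speed A C (γ t))
      ((cubic A C (γ t).1 + (γ t).1 * (3 * (γ t).1 ^ 2 + 2 * A * (γ t).1)) * speed A C (γ t) +
        2 * (γ t).2 ^ 2 * cubic A C (γ t).1) J t := fun t ht => by
  have h1 := hasDerivWithinAt_fst h t ht
  have h2 := hasDerivWithinAt_snd h t ht
  have h3 := (hasDerivAt_cubic A C (γ t).1).comp_hasDerivWithinAt t h1
  have h4 := (h1.fun_mul h3).fun_add (h2.fun_pow 2)
  refine h4.congr_deriv ?_
  simp only [Function.comp]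
  push_cast
  ring

/-- The half-plane `z > 0` is invariant in both time directions. -/
theorem snd_pos_of_pos {a b t₀ : ℝ} (h : IsIntegralCurveOn γ (fun _ => planar A C) (Icc a b))
    (ht₀ : t₀ ∈ Icc a b) (h0 : 0 < (γ t₀).2) : ∀ t ∈ Icc a b, 0 < (γ t).2 := by
  obtain ⟨K, hK⟩ := isCompact_Icc.exists_bound_of_continuousOn
    ((continuous_cubic A C).comp_continuousOn (continuous_fst.comp_continuousOn h.continuousOn))
  have hd := hasDerivWithinAt_snd h
  have hK' : ∀ t ∈ Icc a b, |cubic A C (γ t).1| ≤ K := fun t ht => hK t ht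
  intro t ht
  rcases le_total t t₀ with hle | hle
  · have hs : Icc t t₀ ⊆ Icc a b := Icc_subset_Icc ht.1 ht₀.2
    refine pos_of_deriv_le (K := K) (fun s hs' => (hd s (hs hs')).mono hs) h0
      (fun s hs' hp => ?_) t ⟨le_rfl, hle⟩
    have := (abs_le.1 (hK' s (hs hs'))).2
    nlinarith
  · have hs : Icc t₀ t ⊆ Icc a b := Icc_subset_Icc ht₀.1 ht.2
    refine pos_of_deriv_ge (K := K) (fun s hs' => (hd s (hs hs')).mono hs) h0
      (fun s hs' hp => ?_) t ⟨hle, le_rfl⟩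
    have := (abs_le.1 (hK' s (hs hs'))).1
    nlinarith

end Planar

/-- `γ` is a forward trajectory in `z > 0` that tends to `(ρ, 0)`. -/
structure IsStableOrbit (A C ρ : ℝ) (γ : ℝ → ℝ × ℝ) : Prop where
  sol : IsIntegralCurveOn γ (fun _ => planar A C) (Ici 0)
  start : 0 < (γ 0).2
  tendsto : Tendsto γ atTop (𝓝 (ρ, 0))

namespace IsStableOrbit

variable {A C ρ : ℝ} {γ : ℝ → ℝ × ℝ}

theorem snd_pos (h : IsStableOrbit A C ρ γ) {s : ℝ} (hs : 0 ≤ s) : 0 < (γ s).2 :=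
  snd_pos_of_pos (h.sol.mono (Icc_subset_Ici_self : Icc 0 s ⊆ Ici 0)) (left_mem_Icc.2 hs) h.start s
    (right_mem_Icc.2 hs)

theorem shift (h : IsStableOrbit A C ρ γ) {s : ℝ} (hs : 0 ≤ s) :
    IsStableOrbit A C ρ (fun t => γ (t + s)) where
  sol := isIntegralCurveOn_comp_add_const s h.sol fun t ht => by
    rw [mem_Ici] at ht ⊢; linarith
  start := by simpa using h.snd_pos hs
  tendsto := h.tendsto.comp (tendsto_atTop_add_const_right _ s tendsto_id)

theorem tendsto_fst (h : IsStableOrbit A C ρ γ) : Tendsto (fun s => (γ s).1) atTop (𝓝 ρ) :=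
  (continuous_fst.tendsto (ρ, (0 : ℝ))).comp h.tendsto

theorem tendsto_snd (h : IsStableOrbit A C ρ γ) : Tendsto (fun s => (γ s).2) atTop (𝓝 0) :=
  (continuous_snd.tendsto (ρ, (0 : ℝ))).comp h.tendsto

theorem fst_nonneg (h : IsStableOrbit A C ρ γ) (h0 : 0 ≤ (γ 0).1) {s : ℝ} (hs : 0 ≤ s) :
    0 ≤ (γ s).1 := by
  have hsol := h.sol.mono (Icc_subset_Ici_self : Icc 0 s ⊆ Ici 0)
  refine nonneg_of_deriv_pos_at_zeros (hasDerivWithinAt_fst hsol) h0 (fun t ht hz => ?_) s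
    (right_mem_Icc.2 hs)
  have := h.snd_pos ht.1
  unfold speed
  rw [hz, zero_mul, zero_add]; positivity

/-- On the stable separatrix `w' > 0` wherever `w ≥ 0`: where `w' = 0`, the second derivative is
negative, so `w' ≤ 0` would persist, and `w` would decrease to `ρ`; but `w' > 0` for `w ≥ ρ`. -/
theorem speed_pos_zero (h : IsStableOrbit A C ρ γ) (hρ : IsSaddleRoot A C ρ)
    (h0 : 0 ≤ (γ 0).1) : 0 < speed A C (γ 0) := by
  by_contra hneg
  have hle : ∀ s, 0 ≤ s → speed A C (γ s) ≤ 0 := by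
    intro s hs
    have hsol := h.sol.mono (Icc_subset_Ici_self : Icc 0 s ⊆ Ici 0)
    have := nonneg_of_deriv_pos_at_zeros (fun t ht => (hasDerivWithinAt_speed hsol t ht).fun_neg)
      (by linarith) (fun t ht hz => ?_) s (right_mem_Icc.2 hs)
    · linarith
    · have hz' : speed A C (γ t) = 0 := by linarith
      have h1 := h.snd_pos ht.1
      have h2 := h.fst_nonneg h0 ht.1
      have h3 : cubic A C (γ t).1 < 0 := by
        unfold speed at hz'
        by_contra hc
        have := mul_nonneg h2 (not_lt.1 hc)
        have : 0 < (γ t).2 ^ 2 := by positivity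
        linarith
      rw [hz']
      have : 0 < (γ t).2 ^ 2 := by positivity
      nlinarith
  have hanti : AntitoneOn (fun s => (γ s).1) (Ici 0) := by
    have hd := hasDerivWithinAt_fst h.sol
    refine antitoneOn_of_deriv_nonpos (convex_Ici 0) (fun t ht => (hd t ht).continuousWithinAt)
      (fun t ht => ((hd t (interior_subset ht)).mono interior_subset).differentiableWithinAt)
      fun t ht => ?_
    have := (hd t (interior_subset ht)).hasDerivAt (mem_interior_iff_mem_nhds.1 ht)
    rw [this.deriv]
    exact hle t (interior_subset ht)
  have hge : ρ ≤ (γ 0).1 := by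
    refine le_of_tendsto h.tendsto_fst ?_
    filter_upwards [eventually_ge_atTop 0] with s hs
    exact hanti self_mem_Ici hs hs
  have hg : 0 ≤ cubic A C (γ 0).1 := by
    rcases hge.eq_or_lt with he | hlt
    · rw [← he, hρ.root]
    · exact (hρ.largest _ hlt).le
  have := h.start
  apply hneg
  unfold speed
  have := mul_nonneg h0 hg
  positivity

theorem speed_pos_of_nonneg (h : IsStableOrbit A C ρ γ) (hρ : IsSaddleRoot A C ρ) {s : ℝ}
    (hs : 0 ≤ s) (hw : 0 ≤ (γ s).1) : 0 < speed A C (γ s) := by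
  have := (h.shift hs).speed_pos_zero hρ (by simpa using hw)
  simpa using this

/-- For `w < 0` the sign of `w'` is not automatic on the separatrix; it is positive where
`w g(w) ≥ 0`, and then `w` increases out of that interval into `w ≥ 0`. -/
theorem speed_pos (h : IsStableOrbit A C ρ γ) (hρ : IsSaddleRoot A C ρ)
    (hI : ∀ w, (γ 0).1 ≤ w → w ≤ 0 → 0 ≤ w * cubic A C w) {s : ℝ} (hs : 0 ≤ s) :
    0 < speed A C (γ s) := by
  rcases le_or_gt 0 (γ s).1 with hw | hw
  · exact h.speed_pos_of_nonneg hρ hs hw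
  have hpos : ∀ t, 0 ≤ t → (γ 0).1 ≤ (γ t).1 → (γ t).1 ≤ 0 → 0 < speed A C (γ t) :=
    fun t ht h1 h2 => by
      have := h.snd_pos ht
      have := hI _ h1 h2
      unfold speed; positivity
  by_cases h0 : 0 ≤ (γ 0).1
  · exact absurd (h.fst_nonneg h0 hs) (not_le.2 hw)
  refine hpos s hs ?_ hw.le
  have hsol := h.sol.mono (Icc_subset_Ici_self : Icc 0 s ⊆ Ici 0)
  have := nonneg_of_deriv_pos_at_zeros
    (fun t ht => (hasDerivWithinAt_fst hsol t ht).sub_const (γ 0).1) (by simp)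
    (fun t ht hz => by
      have hz' : (γ t).1 = (γ 0).1 := by linarith
      exact hpos t ht.1 hz'.ge (by linarith)) s (right_mem_Icc.2 hs)
  linarith

theorem tendsto_ratio (h : IsStableOrbit A C ρ γ) (hρ : 0 < ρ) :
    Tendsto (fun s => (γ s).1 / (γ s).2) atTop atTop := by
  have h1 : Tendsto (fun s => (γ s).2) atTop (𝓝[>] 0) := by
    refine tendsto_nhdsWithin_iff.2 ⟨h.tendsto_snd, ?_⟩
    filter_upwards [eventually_ge_atTop 0] with s hs using h.snd_pos hs
  exact h.tendsto_fst.pos_mul_atTop hρ (tendsto_inv_nhdsGT_zero.comp h1)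

/-- The polar variable `x = w / z` satisfies `x' = z`. -/
theorem hasDerivAt_ratio (h : IsStableOrbit A C ρ γ) {s : ℝ} (hs : 0 < s) :
    HasDerivAt (fun s => (γ s).1 / (γ s).2) (γ s).2 s := by
  have h1 := (hasDerivWithinAt_fst h.sol s hs.le).hasDerivAt (Ici_mem_nhds hs)
  have h2 := (hasDerivWithinAt_snd h.sol s hs.le).hasDerivAt (Ici_mem_nhds hs)
  have h3 := h.snd_pos hs.le
  refine (h1.fun_div h2 h3.ne').congr_deriv ?_
  unfold speed
  field_simp
  ring

/-- Every trajectory tending to `(ρ, 0)` in `z > 0` eventually runs along the separatrix: the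
square of its distance to the graph of `Z` is nondecreasing near the saddle and tends to `0`. -/
theorem eventually_on_separatrix (h : IsStableOrbit A C ρ γ) (hρ : IsSaddleRoot A C ρ) {x₀ : ℝ}
    {Z : ℝ → ℝ} (hZ : IsSeparatrix A C ρ x₀ Z) :
    ∀ᶠ s in atTop, (γ s).2 = Z ((γ s).1 / (γ s).2) := by
  obtain ⟨δ, hδ, hδρ, hD⟩ := hρ.exists_cubicDiff_pos
  set x : ℝ → ℝ := fun s => (γ s).1 / (γ s).2 with hx
  have hxt : Tendsto x atTop atTop := h.tendsto_ratio hρ.pos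
  have hnhds : Icc (ρ - δ) (ρ + δ) ∈ 𝓝 ρ := Icc_mem_nhds (by linarith) (by linarith)
  have hxZ : Tendsto (fun s => x s * Z (x s)) atTop (𝓝 ρ) := hZ.tendsto.comp hxt
  have hev : ∀ᶠ s in atTop, 0 < s ∧ (γ s).1 ∈ Icc (ρ - δ) (ρ + δ) ∧
      x s * Z (x s) ∈ Icc (ρ - δ) (ρ + δ) ∧ x₀ < x s := by
    filter_upwards [eventually_gt_atTop 0, h.tendsto_fst.eventually_mem hnhds,
      hxZ.eventually_mem hnhds, hxt.eventually_gt_atTop x₀] with s h1 h2 h3 h4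
    exact ⟨h1, h2, h3, h4⟩
  obtain ⟨S, hS⟩ := eventually_atTop.1 hev
  have hd : ∀ s ∈ Ici S, HasDerivAt (fun s => ((γ s).2 - Z (x s)) ^ 2)
      (2 * ((γ s).2 * cubicDiff A (γ s).1 (x s * Z (x s)) * x s) *
        ((γ s).2 - Z (x s)) ^ 2) s := by
    intro s hs
    obtain ⟨h0, h1, h2, h3⟩ := hS s hs
    have hz := h.snd_pos h0.le
    have hz' := (hasDerivWithinAt_snd h.sol s h0.le).hasDerivAt (Ici_mem_nhds h0)
    have hZ' := (hZ.deriv (x s) h3.le).comp s (h.hasDerivAt_ratio h0)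
    refine ((hz'.fun_sub hZ').fun_pow 2).congr_deriv ?_
    have hw : (γ s).1 = x s * (γ s).2 := by simp only [hx]; field_simp
    have hcs := cubic_sub A C (γ s).1 (x s * Z (x s))
    have hsub : (γ s).1 - x s * Z (x s) = x s * ((γ s).2 - Z (x s)) := by rw [hw]; ring
    rw [hsub] at hcs
    have : (γ s).2 * cubic A C (γ s).1 - cubic A C (x s * Z (x s)) * (γ s).2 =
        (γ s).2 * (cubicDiff A (γ s).1 (x s * Z (x s)) * (x s * ((γ s).2 - Z (x s)))) := by
      rw [← hcs]; ring
    simp only [Function.comp]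
    rw [this]
    push_cast
    ring
  have hmon : MonotoneOn (fun s => ((γ s).2 - Z (x s)) ^ 2) (Ici S) := by
    refine monotoneOn_of_deriv_nonneg (convex_Ici _)
      (fun t ht => (hd t ht).continuousAt.continuousWithinAt)
      (fun t ht => (hd t (interior_subset ht)).differentiableAt.differentiableWithinAt)
      fun t ht => ?_
    have ht := interior_subset ht
    obtain ⟨h0, h1, h2, h3⟩ := hS t ht
    rw [(hd t ht).deriv]
    have := h.snd_pos h0.le
    have := hD _ h1 _ h2
    have : 0 < x t := lt_of_le_of_lt hZ.x₀_nonneg h3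
    positivity
  have hZ0 : Tendsto (fun s => Z (x s)) atTop (𝓝 0) := by
    refine (hxZ.div_atTop hxt).congr' ?_
    filter_upwards [hxt.eventually_gt_atTop 0] with s hs
    field_simp
  have hlim : Tendsto (fun s => ((γ s).2 - Z (x s)) ^ 2) atTop (𝓝 0) := by
    simpa using (h.tendsto_snd.sub hZ0).pow 2
  filter_upwards [eventually_ge_atTop S] with s hs
  have hle : ((γ s).2 - Z (x s)) ^ 2 ≤ 0 := by
    refine ge_of_tendsto hlim ?_
    filter_upwards [eventually_ge_atTop s] with t ht
    exact hmon hs (le_trans (show S ≤ s from hs) ht) ht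
  have := pow_eq_zero_iff (n := 2) two_ne_zero |>.1 (le_antisymm hle (sq_nonneg _))
  linarith

end IsStableOrbit

/-! ### The arc of the stable separatrix -/

/-- The points of the stable separatrix of `(ρ, 0)` in `z > 0` from which `w' > 0` holds all the
way to the saddle. -/
def stableArc (A C ρ : ℝ) : Set (ℝ × ℝ) :=
  {q | ∃ γ, γ 0 = q ∧ IsStableOrbit A C ρ γ ∧ ∀ s, 0 ≤ s → 0 < speed A C (γ s)}

/-- The maximal arc with `w' > 0` through `p` of the trajectory of `p`. -/
def planarArc (A C : ℝ) (p : ℝ × ℝ) : Set (ℝ × ℝ) :=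
  {q | ∃ (T : ℝ) (γ : ℝ → ℝ × ℝ), γ 0 = p ∧ γ T = q ∧
    IsIntegralCurveOn γ (fun _ => planar A C) (uIcc 0 T) ∧ ∀ τ ∈ uIcc 0 T, 0 < speed A C (γ τ)}

section Arc

variable {A C ρ : ℝ} {γ γ' : ℝ → ℝ × ℝ}

theorem IsStableOrbit.strictMonoOn_fst (h : IsStableOrbit A C ρ γ)
    (hp : ∀ s, 0 ≤ s → 0 < speed A C (γ s)) : StrictMonoOn (fun s => (γ s).1) (Ici 0) := by
  have hd := hasDerivWithinAt_fst h.sol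
  refine strictMonoOn_of_deriv_pos (convex_Ici 0) (fun t ht => (hd t ht).continuousWithinAt)
    fun t ht => ?_
  have := (hd t (interior_subset ht)).hasDerivAt (mem_interior_iff_mem_nhds.1 ht)
  rw [this.deriv]
  exact hp t (interior_subset ht)

theorem IsStableOrbit.fst_lt (h : IsStableOrbit A C ρ γ)
    (hp : ∀ s, 0 ≤ s → 0 < speed A C (γ s)) {s : ℝ} (hs : 0 ≤ s) : (γ s).1 < ρ := by
  have hm := h.strictMonoOn_fst hp
  have h1 : (γ s).1 < (γ (s + 1)).1 :=
    hm hs (show (0 : ℝ) ≤ s + 1 by linarith) (by linarith)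
  refine h1.trans_le (ge_of_tendsto h.tendsto_fst ?_)
  filter_upwards [eventually_ge_atTop (s + 1)] with t ht
  exact hm.monotoneOn (show (0 : ℝ) ≤ s + 1 by linarith) (show (0 : ℝ) ≤ t by linarith) ht

theorem fst_lt_of_mem_stableArc {q : ℝ × ℝ} (hq : q ∈ stableArc A C ρ) : q.1 < ρ := by
  obtain ⟨γ, rfl, h, hp⟩ := hq
  exact h.fst_lt hp le_rfl

theorem snd_pos_of_mem_stableArc {q : ℝ × ℝ} (hq : q ∈ stableArc A C ρ) : 0 < q.2 := by
  obtain ⟨γ, rfl, h, -⟩ := hq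
  exact h.start

theorem shift_mem_stableArc (h : IsStableOrbit A C ρ γ)
    (hp : ∀ s, 0 ≤ s → 0 < speed A C (γ s)) {s : ℝ} (hs : 0 ≤ s) : γ s ∈ stableArc A C ρ :=
  ⟨fun t => γ (t + s), by simp, h.shift hs, fun t ht => hp _ (by linarith)⟩

/-- If two arcs meet, the earlier start lies on the trajectory of the other one, and monotonicity of
`w` excludes distinct starts over the same `w`. -/
theorem eq_of_meet (h : IsStableOrbit A C ρ γ) (h' : IsStableOrbit A C ρ γ')
    (hp' : ∀ s, 0 ≤ s → 0 < speed A C (γ' s)) {s s' : ℝ} (hs : 0 ≤ s) (hss : s ≤ s')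
    (hmeet : γ s = γ' s') (heq : (γ 0).1 = (γ' 0).1) : γ 0 = γ' 0 := by
  have hsub : 0 ≤ s' - s := by linarith
  have hsol := (h'.shift hsub).sol.mono (Icc_subset_Ici_self : Icc 0 s ⊆ Ici 0)
  have h0 := eqOn_of_eq_right (contDiff_planar A C)
    (h.sol.mono (Icc_subset_Ici_self : Icc 0 s ⊆ Ici 0)) hsol (by simpa using hmeet)
    (left_mem_Icc.2 hs)
  simp only [zero_add] at h0
  rcases hsub.eq_or_lt with he | hlt
  · rw [h0, ← he]
  · have h1 : (γ' 0).1 < (γ' (s' - s)).1 := h'.strictMonoOn_fst hp' self_mem_Ici hsub hlt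
    rw [← h0, heq] at h1
    exact absurd h1 (lt_irrefl _)

theorem IsStableOrbit.exists_ratio_eq (h : IsStableOrbit A C ρ γ) (hρ : 0 < ρ) {S X : ℝ}
    (hS : 0 ≤ S) (hX : (γ S).1 / (γ S).2 ≤ X) : ∃ s ≥ S, (γ s).1 / (γ s).2 = X := by
  obtain ⟨t, ht1, ht2⟩ := (((h.tendsto_ratio hρ).eventually_ge_atTop X).and
    (eventually_ge_atTop S)).exists
  have hc : ContinuousOn (fun s => (γ s).1 / (γ s).2) (Icc S t) := by
    have hc := h.sol.continuousOn.mono (fun r hr => hS.trans hr.1 : Icc S t ⊆ Ici 0)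
    exact (continuous_fst.comp_continuousOn hc).div (continuous_snd.comp_continuousOn hc)
      fun r hr => (h.snd_pos (hS.trans hr.1)).ne'
  obtain ⟨s, hs, hsX⟩ := intermediate_value_Icc ht2 hc ⟨hX, ht1⟩
  exact ⟨s, hs.1, hsX⟩

/-- The arc is a graph over the `w`-axis. -/
theorem stableArc_height_unique (hρ : IsSaddleRoot A C ρ) {w z z' : ℝ}
    (h : (w, z) ∈ stableArc A C ρ) (h' : (w, z') ∈ stableArc A C ρ) : z = z' := by
  obtain ⟨x₀, Z, hZ⟩ := hρ.exists_isSeparatrix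
  obtain ⟨γ, h0, ho, hp⟩ := h
  obtain ⟨γ', h0', ho', hp'⟩ := h'
  obtain ⟨S, hS⟩ := eventually_atTop.1
    ((ho.eventually_on_separatrix hρ hZ).and (eventually_ge_atTop 0))
  obtain ⟨S', hS'⟩ := eventually_atTop.1
    ((ho'.eventually_on_separatrix hρ hZ).and (eventually_ge_atTop 0))
  obtain ⟨s, hs, hsX⟩ := ho.exists_ratio_eq hρ.pos (hS S le_rfl).2
    (le_max_left ((γ S).1 / (γ S).2) ((γ' S').1 / (γ' S').2))
  obtain ⟨s', hs', hsX'⟩ := ho'.exists_ratio_eq hρ.pos (hS' S' le_rfl).2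
    (le_max_right ((γ S).1 / (γ S).2) ((γ' S').1 / (γ' S').2))
  have hs0 := (hS s hs).2
  have hs0' := (hS' s' hs').2
  have e2 : (γ s).2 = (γ' s').2 := by rw [(hS s hs).1, (hS' s' hs').1, hsX, hsX']
  have e1 : (γ s).1 = (γ' s').1 := by
    have h1 := (ho.snd_pos hs0).ne'
    have h2 : (γ s).1 / (γ s).2 = (γ' s').1 / (γ s).2 := by rw [hsX, e2, hsX']
    field_simp at h2
    exact h2
  have hmeet : γ s = γ' s' := Prod.ext e1 e2
  have heq : (γ 0).1 = (γ' 0).1 := by rw [h0, h0']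
  have : γ 0 = γ' 0 := by
    rcases le_total s s' with hle | hle
    · exact eq_of_meet ho ho' hp' hs0 hle hmeet heq
    · exact (eq_of_meet ho' ho hp hs0' hle hmeet.symm heq.symm).symm
  rw [h0, h0'] at this
  exact (Prod.ext_iff.1 this).2

theorem exists_mem_stableArc_of_le {w z w' : ℝ} (h : (w, z) ∈ stableArc A C ρ) (hw : w ≤ w')
    (hw' : w' < ρ) : ∃ z', (w', z') ∈ stableArc A C ρ := by
  obtain ⟨γ, h0, ho, hp⟩ := h
  obtain ⟨t, ht1, ht2⟩ := ((ho.tendsto_fst.eventually_const_lt hw').and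
    (eventually_ge_atTop 0)).exists
  have hc : ContinuousOn (fun s => (γ s).1) (Icc 0 t) := continuous_fst.comp_continuousOn
    (ho.sol.continuousOn.mono Icc_subset_Ici_self)
  obtain ⟨s, hs, hsw⟩ := intermediate_value_Icc ht2 hc
    (show w' ∈ Icc (γ 0).1 (γ t).1 from ⟨by rw [h0]; exact hw, ht1.le⟩)
  refine ⟨(γ s).2, ?_⟩
  have := shift_mem_stableArc ho hp hs.1
  rwa [← hsw]

/-! ### The arcs through points of the separatrix near the saddle -/

theorem isIntegralCurveOn_glue {F : ℝ × ℝ → ℝ × ℝ} {T : ℝ} (hT : T ≤ 0)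
    (h : IsIntegralCurveOn γ (fun _ => F) (Icc T 0))
    (h' : IsIntegralCurveOn γ' (fun _ => F) (Ici 0)) (heq : γ 0 = γ' 0) :
    IsIntegralCurveOn (fun t => if t ≤ 0 then γ t else γ' t) (fun _ => F) (Ici T) := by
  set η : ℝ → ℝ × ℝ := fun t => if t ≤ 0 then γ t else γ' t with hη
  have hl : ∀ t ≤ 0, η t = γ t := fun t ht => if_pos ht
  have hr : ∀ t ≥ 0, η t = γ' t := fun t ht => by
    rcases (show 0 ≤ t from ht).eq_or_lt with rfl | hlt
    · rw [hl 0 le_rfl, heq]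
    · exact if_neg (not_le.2 hlt)
  have h1 : ∀ t ∈ Icc T 0, HasDerivWithinAt η (F (η t)) (Icc T 0) t := fun t ht => by
    rw [hl t ht.2]
    exact (h t ht).congr (fun s hs => hl s hs.2) (hl t ht.2)
  have h2 : ∀ t ∈ Ici (0 : ℝ), HasDerivWithinAt η (F (η t)) (Ici 0) t := fun t ht => by
    rw [hr t ht]
    exact (h' t ht).congr (fun s hs => hr s hs) (hr t ht)
  intro t ht
  rcases lt_trichotomy t 0 with hlt | rfl | hgt
  · refine (h1 t ⟨ht, hlt.le⟩).mono_of_mem_nhdsWithin ?_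
    rw [← Ici_inter_Iic]
    exact inter_mem_nhdsWithin _ (Iic_mem_nhds hlt)
  · have := (h1 0 ⟨hT, le_rfl⟩).union (h2 0 self_mem_Ici)
    rwa [Icc_union_Ici_eq_Ici hT] at this
  · exact ((h2 t hgt.le).hasDerivAt (Ici_mem_nhds hgt)).hasDerivWithinAt

/-- The arc through a point of the separatrix consists of points of the separatrix: forwards by
uniqueness of solutions, backwards by concatenation. -/
theorem mem_stableArc_of_mem_planarArc (hρ : IsSaddleRoot A C ρ) (ho : IsStableOrbit A C ρ γ)
    (hI : ∀ w, (γ 0).1 ≤ w → w ≤ 0 → 0 ≤ w * cubic A C w) {q : ℝ × ℝ}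
    (hq : q ∈ planarArc A C (γ 0)) : q ∈ stableArc A C ρ := by
  obtain ⟨T, γ₁, h0, rfl, hsol, hpos⟩ := hq
  have hp : ∀ s, 0 ≤ s → 0 < speed A C (γ s) := fun s hs => ho.speed_pos hρ hI hs
  rcases le_total 0 T with hT | hT
  · rw [uIcc_of_le hT] at hsol
    have := eqOn_of_eq_left (contDiff_planar A C) hsol
      (ho.sol.mono (Icc_subset_Ici_self : Icc 0 T ⊆ Ici 0)) h0 (right_mem_Icc.2 hT)
    rw [this]
    exact shift_mem_stableArc ho hp hT
  · rw [uIcc_of_ge hT] at hsol hpos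
    have hglue := isIntegralCurveOn_glue hT hsol ho.sol h0
    set η : ℝ → ℝ × ℝ := fun t => if t ≤ 0 then γ₁ t else γ t with hη
    refine ⟨fun t => η (t + T), ?_, ⟨?_, ?_, ?_⟩, fun s hs => ?_⟩
    · simp [hη, hT]
    · exact isIntegralCurveOn_comp_add_const T hglue fun t ht => by
        rw [mem_Ici] at ht ⊢; linarith
    · have := snd_pos_of_pos hsol (right_mem_Icc.2 hT) (by rw [h0]; exact ho.start) T
        (left_mem_Icc.2 hT)
      simpa [hη, hT] using this
    · have h1 : Tendsto (fun t => γ (t + T)) atTop (𝓝 (ρ, 0)) :=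
        ho.tendsto.comp (tendsto_atTop_add_const_right _ T tendsto_id)
      refine h1.congr' ?_
      filter_upwards [eventually_gt_atTop (-T)] with t ht
      exact (if_neg (by linarith)).symm
    · rcases le_or_gt (s + T) 0 with hs' | hs'
      · have : η (s + T) = γ₁ (s + T) := if_pos hs'
        simp only [this]
        exact hpos _ ⟨by linarith, hs'⟩
      · have : η (s + T) = γ (s + T) := if_neg (not_le.2 hs')
        simp only [this]
        exact hp _ hs'.le

theorem exists_near_saddle_of_mem_stableArc {q : ℝ × ℝ} (hq : q ∈ stableArc A C ρ) {c : ℝ}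
    (hc : c < ρ) : ∃ γ, IsStableOrbit A C ρ γ ∧ c < (γ 0).1 ∧ (γ 0).1 < ρ ∧
      0 < speed A C (γ 0) ∧ q ∈ planarArc A C (γ 0) := by
  obtain ⟨γ, rfl, ho, hp⟩ := hq
  obtain ⟨s, hs1, hs2⟩ := ((ho.tendsto_fst.eventually_const_lt hc).and
    (eventually_ge_atTop 0)).exists
  refine ⟨fun t => γ (t + s), ho.shift hs2, by simpa using hs1,
    by simpa using ho.fst_lt hp hs2, by simpa using hp s hs2, -s, fun t => γ (t + s), rfl,
    by simp, ?_, fun t ht => ?_⟩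
  · refine isIntegralCurveOn_comp_add_const s ho.sol fun t ht => ?_
    rw [uIcc_of_ge (by linarith)] at ht
    rw [mem_Ici]; linarith [ht.1]
  · rw [uIcc_of_ge (by linarith)] at ht
    exact hp _ (by linarith [ht.1])

/-! ### The graph of `Z` as a trajectory -/

/-- The autonomous scalar equation `x' = V(x)` with `0 < V ≤ B` is solved by inverting
`∫ dx / V(x)`. -/
theorem exists_time_change {V : ℝ → ℝ} (hc : Continuous V) (hpos : ∀ x, 0 < V x) {B : ℝ}
    (hB : ∀ x, V x ≤ B) (x₁ : ℝ) : ∃ x : ℝ → ℝ, x 0 = x₁ ∧ (∀ s, HasDerivAt x (V (x s)) s) ∧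
      Monotone x ∧ Tendsto x atTop atTop := by
  have hBpos : 0 < B := (hpos 0).trans_le (hB 0)
  have hci : Continuous fun x => (V x)⁻¹ := hc.inv₀ fun x => (hpos x).ne'
  set T : ℝ → ℝ := fun x => ∫ t in x₁..x, (V t)⁻¹ with hT
  have hd : ∀ x, HasDerivAt T (V x)⁻¹ x := fun x => (hci.integral_hasStrictDerivAt x₁ x).hasDerivAt
  have hmono : StrictMono T := strictMono_of_deriv_pos fun x => by
    rw [(hd x).deriv]; exact inv_pos.2 (hpos x)
  have hm2 : Monotone fun x => T x - B⁻¹ * x := by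
    have hd2 : ∀ x, HasDerivAt (fun x => T x - B⁻¹ * x) ((V x)⁻¹ - B⁻¹ * 1) x := fun x =>
      (hd x).fun_sub ((hasDerivAt_id' x).const_mul _)
    refine monotone_of_deriv_nonneg (fun x => (hd2 x).differentiableAt) fun x => ?_
    rw [(hd2 x).deriv, mul_one, sub_nonneg]
    exact inv_anti₀ (hpos x) (hB x)
  have htop : Tendsto T atTop atTop := by
    have h1 : Tendsto (fun x => B⁻¹ * x + (T 0 - B⁻¹ * 0)) atTop atTop :=
      tendsto_atTop_add_const_right _ _ (tendsto_id.const_mul_atTop (inv_pos.2 hBpos))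
    refine tendsto_atTop_mono' _ ?_ h1
    filter_upwards [eventually_ge_atTop 0] with x hx
    have := hm2 hx
    simp only at this
    linarith
  have hbot : Tendsto T atBot atBot := by
    have h1 : Tendsto (fun x => B⁻¹ * x + (T 0 - B⁻¹ * 0)) atBot atBot :=
      tendsto_atBot_add_const_right _ _ (tendsto_id.const_mul_atBot (inv_pos.2 hBpos))
    refine tendsto_atBot_mono' _ ?_ h1
    filter_upwards [eventually_le_atBot 0] with x hx
    have := hm2 hx
    simp only at this
    linarith
  have hcont : Continuous T := continuous_iff_continuousAt.2 fun x => (hd x).continuousAt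
  set e := hmono.orderIsoOfSurjective T (hcont.surjective htop hbot) with he
  have hTe : ∀ s, T (e.symm s) = s := fun s => e.apply_symm_apply s
  refine ⟨e.symm, ?_, fun s => ?_, e.symm.monotone, e.symm.tendsto_atTop⟩
  · have : T x₁ = 0 := by simp [hT]
    rw [← this]
    exact e.symm_apply_apply x₁
  · have := HasDerivAt.of_local_left_inverse (f := T) (g := e.symm) (a := s)
      e.symm.continuous.continuousAt (hd _) (inv_ne_zero (hpos _).ne') (Eventually.of_forall hTe)
    rwa [inv_inv] at this

namespace IsSeparatrix

variable {x₀ : ℝ} {Z : ℝ → ℝ}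

theorem tendsto_zero (hZ : IsSeparatrix A C ρ x₀ Z) : Tendsto Z atTop (𝓝 0) := by
  refine (hZ.tendsto.div_atTop tendsto_id).congr' ?_
  filter_upwards [eventually_gt_atTop 0] with x hx
  simp only [id]
  field_simp

theorem mem_stableArc_of_forall (hZ : IsSeparatrix A C ρ x₀ Z) (hρ : IsSaddleRoot A C ρ) {x₁ : ℝ}
    (hd : ∀ x ≥ x₁, HasDerivAt Z (cubic A C (x * Z x)) x) (hpos : ∀ x ≥ x₁, 0 < Z x)
    (hsp : ∀ x ≥ x₁, x < 0 → 0 < Z x + x * cubic A C (x * Z x)) :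
    (x₁ * Z x₁, Z x₁) ∈ stableArc A C ρ := by
  set V : ℝ → ℝ := fun x => Z (max x₁ x) with hV
  have hVc : Continuous V := by
    refine continuous_iff_continuousAt.2 fun x => ?_
    exact (hd _ (le_max_left x₁ x)).continuousAt.comp (f := fun x => max x₁ x)
      (continuous_const.max continuous_id).continuousAt
  have hVeq : ∀ x ≥ x₁, V x = Z x := fun x hx => by simp only [hV]; rw [max_eq_right hx]
  obtain ⟨B, hB⟩ : ∃ B, ∀ x, V x ≤ B := by
    obtain ⟨Y, hY⟩ := eventually_atTop.1 (hZ.tendsto_zero.eventually_le_const zero_lt_one)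
    obtain ⟨R, hR⟩ := (isCompact_Icc (a := x₁) (b := max x₁ Y)).exists_bound_of_continuousOn
      hVc.continuousOn
    refine ⟨max R 1, fun x => ?_⟩
    rcases le_or_gt (max x₁ x) (max x₁ Y) with hx | hx
    · have := hR _ ⟨le_max_left _ _, hx⟩
      have h1 : V (max x₁ x) = V x := by simp [hV]
      rw [h1] at this
      exact ((le_abs_self _).trans this).trans (le_max_left _ _)
    · exact (hY _ ((le_max_right x₁ Y).trans hx.le)).trans (le_max_right _ _)
  obtain ⟨x, hx0, hxd, hxm, hxt⟩ := exists_time_change hVc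
    (fun x => hpos _ (le_max_left x₁ x)) hB x₁
  have hxge : ∀ s, 0 ≤ s → x₁ ≤ x s := fun s hs => by rw [← hx0]; exact hxm hs
  have ho : IsStableOrbit A C ρ fun s => (x s * Z (x s), Z (x s)) := by
    refine ⟨fun s hs => ?_, ?_, ?_⟩
    · have h1 := hxd s
      rw [hVeq _ (hxge s hs)] at h1
      have h2 := (hd _ (hxge s hs)).comp s h1
      have h3 := h1.fun_mul h2
      refine (h3.prodMk h2).hasDerivWithinAt.congr_deriv ?_
      simp only [planar, speed, Function.comp]
      ext <;> simp only <;> ring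
    · simp only [hx0]; exact hpos x₁ le_rfl
    · exact (hZ.tendsto.comp hxt).prodMk_nhds (hZ.tendsto_zero.comp hxt)
  refine ⟨_, by simp only [hx0], ho, fun s hs => ?_⟩
  have hz := hpos _ (hxge s hs)
  rcases le_or_gt 0 (x s) with hxs | hxs
  · exact ho.speed_pos_of_nonneg hρ hs (by positivity)
  · have := mul_pos hz (hsp _ (hxge s hs) hxs)
    simp only [speed]
    linarith

theorem mem_stableArc (hZ : IsSeparatrix A C ρ x₀ Z) (hρ : IsSaddleRoot A C ρ) {x : ℝ}
    (hx : x₀ < x) : (x * Z x, Z x) ∈ stableArc A C ρ :=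
  hZ.mem_stableArc_of_forall hρ (fun t ht => hZ.deriv t (hx.le.trans ht))
    (fun t ht => hZ.pos t (lt_of_lt_of_le hx ht)) fun t ht ht0 => by
      have := hZ.x₀_nonneg
      have : x ≤ t := ht
      linarith

theorem x₀_eq_zero (hZ : IsSeparatrix A C ρ x₀ Z) (h0 : 0 < Z x₀) : x₀ = 0 := by
  rcases mul_eq_zero.1 hZ.end_mul with h | h
  · exact h
  · linarith

/-- If the separatrix reaches the `z`-axis above the origin, it crosses into `w < 0`. -/
theorem exists_past_mem_stableArc (hZ : IsSeparatrix A C ρ x₀ Z) (hρ : IsSaddleRoot A C ρ)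
    (h0 : 0 < Z x₀) : (0, Z x₀) ∈ stableArc A C ρ ∧
      ∃ w < 0, ∃ z, (w, z) ∈ stableArc A C ρ := by
  have hx₀ := hZ.x₀_eq_zero h0
  subst hx₀
  obtain ⟨ε, hε, hp⟩ := hZ.past h0
  have hc : ContinuousAt (fun x => Z x + x * cubic A C (x * Z x)) 0 := by
    have hcZ := (hp 0 (by linarith)).1.continuousAt
    exact hcZ.add (continuousAt_id.mul
      ((continuous_cubic A C).continuousAt.comp (f := fun x => x * Z x) (continuousAt_id.mul hcZ)))
  have hev : ∀ᶠ x in 𝓝 (0 : ℝ), 0 < Z x + x * cubic A C (x * Z x) :=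
    hc.eventually_const_lt (by simpa using h0)
  obtain ⟨ε', hε', hb⟩ := Metric.eventually_nhds_iff.1 hev
  have hmem : ∀ x, -min ε ε' < x → (x * Z x, Z x) ∈ stableArc A C ρ := fun x hx => by
    have h1 := min_le_left ε ε'
    have h2 := min_le_right ε ε'
    refine hZ.mem_stableArc_of_forall hρ (fun t ht => (hp t ?_).1) (fun t ht => (hp t ?_).2)
      fun t ht ht0 => hb ?_
    · have : x ≤ t := ht
      linarith
    · have : x ≤ t := ht
      linarith
    · have : x ≤ t := ht
      rw [Real.dist_eq, abs_lt]; constructor <;> linarith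
  have hmin : 0 < min ε ε' := lt_min hε hε'
  refine ⟨by simpa using hmem 0 (by linarith), _, ?_, _, hmem (-min ε ε' / 2) (by linarith)⟩
  have := (hp (-min ε ε' / 2) (by linarith [min_le_left ε ε'])).2
  nlinarith

theorem strictMonoOn (hZ : IsSeparatrix A C ρ x₀ Z) (hρ : IsSaddleRoot A C ρ) :
    StrictMonoOn (fun x => x * Z x) (Ici x₀) := by
  have hd : ∀ x ≥ x₀, HasDerivAt (fun x => x * Z x) (1 * Z x + x * cubic A C (x * Z x)) x :=
    fun x hx => (hasDerivAt_id' x).fun_mul (hZ.deriv x hx)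
  refine strictMonoOn_of_deriv_pos (convex_Ici _)
    (fun x hx => (hd x hx).continuousAt.continuousWithinAt) fun x hx => ?_
  rw [interior_Ici, mem_Ioi] at hx
  rw [(hd x hx.le).deriv]
  obtain ⟨γ, h0, ho, hp⟩ := hZ.mem_stableArc hρ hx
  have h1 := hp 0 le_rfl
  rw [h0] at h1
  have hz := hZ.pos x hx
  have h2 : speed A C (x * Z x, Z x) = Z x * (1 * Z x + x * cubic A C (x * Z x)) := by
    simp only [speed]; ring
  rw [h2] at h1
  exact pos_of_mul_pos_right h1 hz.le

theorem exists_eq (hZ : IsSeparatrix A C ρ x₀ Z) {w : ℝ} (hw : 0 < w) (hwρ : w < ρ) :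
    ∃ x > x₀, x * Z x = w := by
  obtain ⟨t, ht1, ht2⟩ := ((hZ.tendsto.eventually_const_lt hwρ).and
    (eventually_ge_atTop x₀)).exists
  have hc : ContinuousOn (fun x => x * Z x) (Icc x₀ t) := fun x hx =>
    (continuousAt_id.mul (hZ.deriv x hx.1).continuousAt).continuousWithinAt
  obtain ⟨x, hx, hxw⟩ := intermediate_value_Icc ht2 hc
    (show w ∈ Icc (x₀ * Z x₀) (t * Z t) from ⟨by rw [hZ.end_mul]; exact hw.le, ht1.le⟩)
  refine ⟨x, lt_of_le_of_ne hx.1 fun h => ?_, hxw⟩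
  subst h
  rw [← hxw] at hw
  exact hw.ne' hZ.end_mul

end IsSeparatrix

end Arc

/-! ### The end of the separatrix on the `z`-axis -/

namespace IsSeparatrix

variable {A C ρ x₀ : ℝ} {Z : ℝ → ℝ}

theorem exists_of_mem_stableArc (hZ : IsSeparatrix A C ρ x₀ Z) (hρ : IsSaddleRoot A C ρ) {w z : ℝ}
    (hw : 0 < w) (h : (w, z) ∈ stableArc A C ρ) : ∃ x > x₀, x * Z x = w ∧ Z x = z := by
  obtain ⟨x, hx, hxw⟩ := hZ.exists_eq hw (fst_lt_of_mem_stableArc h)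
  have h1 := hZ.mem_stableArc hρ hx
  rw [hxw] at h1
  exact ⟨x, hx, hxw, stableArc_height_unique hρ h1 h⟩

theorem tendsto_height (hZ : IsSeparatrix A C ρ x₀ Z) (hρ : IsSaddleRoot A C ρ) {η : ℝ → ℝ}
    (hη : ∀ w, 0 < w → w < ρ → (w, η w) ∈ stableArc A C ρ) :
    Tendsto η (𝓝[>] 0) (𝓝 (Z x₀)) := by
  rw [Metric.tendsto_nhds]
  intro ε hε
  have hc := (hZ.deriv x₀ le_rfl).continuousAt
  obtain ⟨δ, hδ, hb⟩ := Metric.continuousAt_iff.1 hc ε hε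
  have hx1 : x₀ < x₀ + δ / 2 := by linarith
  have hw1 : 0 < (x₀ + δ / 2) * Z (x₀ + δ / 2) :=
    mul_pos (by linarith [hZ.x₀_nonneg]) (hZ.pos _ hx1)
  filter_upwards [Ioo_mem_nhdsGT (lt_min hw1 hρ.pos)] with w hw
  obtain ⟨x, hx, hxw, hxz⟩ := hZ.exists_of_mem_stableArc hρ hw.1
    (hη w hw.1 (hw.2.trans_le (min_le_right _ _)))
  have hlt : x < x₀ + δ / 2 := by
    refine (hZ.strictMonoOn hρ).lt_iff_lt (show x₀ ≤ x from hx.le) (show x₀ ≤ _ from hx1.le) |>.1 ?_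
    simp only [hxw]
    exact hw.2.trans_le (min_le_left _ _)
  rw [← hxz]
  refine hb ?_
  rw [Real.dist_eq, abs_lt]; constructor <;> linarith

/-- If the separatrix ends at the origin, it does not reach `w ≤ 0`: otherwise it would pass over
`w = 0` at a positive height, which is also the limit of the heights, that is, `Z x₀ = 0`. -/
theorem pos_of_mem_stableArc (hZ : IsSeparatrix A C ρ x₀ Z) (hρ : IsSaddleRoot A C ρ)
    (h0 : Z x₀ = 0) {q : ℝ × ℝ} (hq : q ∈ stableArc A C ρ) : 0 < q.1 := by
  by_contra hneg
  obtain ⟨z', hz'⟩ := exists_mem_stableArc_of_le (w := q.1) (z := q.2) hq (not_lt.1 hneg) hρ.pos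
  have hex : ∀ w, 0 < w → w < ρ → ∃ z, (w, z) ∈ stableArc A C ρ := fun w h1 h2 =>
    exists_mem_stableArc_of_le hz' h1.le h2
  choose! η hη using hex
  have hlim := hZ.tendsto_height hρ hη
  have hz'pos : 0 < z' := snd_pos_of_mem_stableArc hz'
  obtain ⟨γ, hγ0, ho, hp⟩ := hz'
  have hc : ContinuousWithinAt γ (Ioi 0) 0 :=
    (ho.sol.continuousOn 0 self_mem_Ici).mono Ioi_subset_Ici_self
  have h1 : Tendsto (fun s => (γ s).1) (𝓝[>] 0) (𝓝[>] 0) := by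
    refine tendsto_nhdsWithin_iff.2 ⟨?_, ?_⟩
    · have := (continuous_fst.tendsto (γ 0)).comp hc
      rwa [hγ0] at this
    · filter_upwards [self_mem_nhdsWithin] with s hs
      have := ho.strictMonoOn_fst hp self_mem_Ici (show (0 : ℝ) ≤ s from le_of_lt hs) hs
      simp only [hγ0] at this
      exact this
  have h2 : Tendsto (fun s => (γ s).2) (𝓝[>] 0) (𝓝 z') := by
    have := (continuous_snd.tendsto (γ 0)).comp hc
    rwa [hγ0] at this
  have h3 : Tendsto (fun s => (γ s).2) (𝓝[>] 0) (𝓝 (Z x₀)) := by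
    refine (hlim.comp h1).congr' ?_
    filter_upwards [self_mem_nhdsWithin, h1.eventually self_mem_nhdsWithin] with s hs hs1
    have hm := shift_mem_stableArc ho hp (le_of_lt (show 0 < s from hs))
    exact stableArc_height_unique hρ (hη _ hs1 (fst_lt_of_mem_stableArc hm)) hm
  have := tendsto_nhds_unique h2 h3
  linarith

/-- If `g < 0` on `(0, ρ)`, then `z` increases backwards and the separatrix cannot end at the
origin. -/
theorem end_pos_of_neg (hZ : IsSeparatrix A C ρ x₀ Z) (hρ : IsSaddleRoot A C ρ)
    (hneg : ∀ w, 0 < w → w < ρ → cubic A C w < 0) : 0 < Z x₀ := by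
  have hanti : AntitoneOn Z (Ici x₀) := by
    refine antitoneOn_of_deriv_nonpos (convex_Ici _)
      (fun x hx => (hZ.deriv x hx).continuousAt.continuousWithinAt)
      (fun x hx => (hZ.deriv x (interior_subset hx)).differentiableAt.differentiableWithinAt)
      fun x hx => ?_
    rw [interior_Ici, mem_Ioi] at hx
    rw [(hZ.deriv x hx.le).deriv]
    exact (hneg _ (mul_pos (hZ.x₀_nonneg.trans_lt hx) (hZ.pos x hx))
      (fst_lt_of_mem_stableArc (hZ.mem_stableArc hρ hx))).le
  have h1 := hanti self_mem_Ici (show x₀ + 1 ∈ Ici x₀ by rw [mem_Ici]; linarith)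
    (by linarith : x₀ ≤ x₀ + 1)
  exact (hZ.pos (x₀ + 1) (by linarith)).trans_le h1

end IsSeparatrix

/-! ### Comparison of separatrices -/

theorem IsSaddleRoot.lt_of_lt {A A' C ρ ρ' : ℝ} (hρ : IsSaddleRoot A C ρ)
    (hρ' : IsSaddleRoot A' C ρ') (hA : A < A') : ρ' < ρ := by
  by_contra hle
  have h1 : 0 ≤ cubic A C ρ' := by
    rcases (not_lt.1 hle).eq_or_lt with he | hlt
    · rw [← he, hρ.root]
    · exact (hρ.largest _ hlt).le
  have h2 := hρ'.root
  have h3 : 0 < (A' - A) * ρ' ^ 2 := by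
    have := hρ'.pos
    have : 0 < A' - A := by linarith
    positivity
  unfold cubic at h1 h2
  linarith

namespace IsSeparatrix

variable {A C ρ x₀ : ℝ} {Z : ℝ → ℝ}
variable {A' ρ' x₀' : ℝ} {Z' : ℝ → ℝ}

/-- Increasing `A` lowers the separatrix: the difference `D` of the two graphs satisfies
`dD/dx = c(x) D - (A' - A) (x Z')² ≤ c(x) D` and is positive for large `x`, hence everywhere. -/
theorem lt_of_lt (hZ : IsSeparatrix A C ρ x₀ Z) (hZ' : IsSeparatrix A' C ρ' x₀' Z')
    (hρ : IsSaddleRoot A C ρ) (hρ' : IsSaddleRoot A' C ρ') (hA : A < A') {x : ℝ} (hx : x₀ ≤ x)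
    (hx' : x₀' ≤ x) : Z' x < Z x := by
  have hroot := hρ.lt_of_lt hρ' hA
  have hev : ∀ᶠ y in atTop, y * Z' y < y * Z y :=
    hZ'.tendsto.eventually_lt hZ.tendsto hroot
  obtain ⟨X, hX1, hX2, hX3⟩ := (hev.and ((eventually_ge_atTop x).and
    (eventually_gt_atTop 0))).exists
  have hXpos : 0 < Z X - Z' X := by
    have := lt_of_mul_lt_mul_left hX1 hX3.le
    linarith
  have hd : ∀ t ∈ Icc x X, HasDerivAt (fun t => Z t - Z' t)
      (cubic A C (t * Z t) - cubic A' C (t * Z' t)) t := fun t ht =>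
    (hZ.deriv t (hx.trans ht.1)).fun_sub (hZ'.deriv t (hx'.trans ht.1))
  have hcd : ContinuousOn (fun t => t * cubicDiff A (t * Z t) (t * Z' t)) (Icc x X) := by
    have h1 : ContinuousOn Z (Icc x X) := fun t ht =>
      (hZ.deriv t (hx.trans ht.1)).continuousAt.continuousWithinAt
    have h2 : ContinuousOn Z' (Icc x X) := fun t ht =>
      (hZ'.deriv t (hx'.trans ht.1)).continuousAt.continuousWithinAt
    unfold cubicDiff
    fun_prop
  obtain ⟨K, hK⟩ := isCompact_Icc.exists_bound_of_continuousOn hcd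
  have := pos_of_deriv_le (K := K) (fun t ht => (hd t ht).hasDerivWithinAt) hXpos
    (fun t ht hp => by
      have h1 := (abs_le.1 (hK t ht)).2
      have h2 : cubic A C (t * Z t) - cubic A' C (t * Z' t) =
          t * cubicDiff A (t * Z t) (t * Z' t) * (Z t - Z' t) - (A' - A) * (t * Z' t) ^ 2 := by
        unfold cubic cubicDiff; ring
      rw [h2]
      have h3 : 0 ≤ (A' - A) * (t * Z' t) ^ 2 := mul_nonneg (by linarith) (sq_nonneg _)
      nlinarith) x ⟨le_rfl, hX2⟩
  linarith

theorem x₀_le_x₀ (hZ : IsSeparatrix A C ρ x₀ Z) (hZ' : IsSeparatrix A' C ρ' x₀' Z')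
    (hρ : IsSaddleRoot A C ρ) (hρ' : IsSaddleRoot A' C ρ') (hA : A < A') : x₀ ≤ x₀' := by
  by_contra hlt
  have hlt := not_le.1 hlt
  have h1 := hZ.lt_of_lt hZ' hρ hρ' hA le_rfl hlt.le
  have h2 := hZ'.pos x₀ hlt
  rw [hZ.x₀_eq_zero (h2.trans h1)] at hlt
  linarith [hZ'.x₀_nonneg]

/-- Comparison at equal `w` rather than equal `x = w / z`: since `x Z(x)` increases, the higher
curve passes over `w` at a smaller `x`, hence with larger `z = w / x`. -/
theorem height_lt_height (hZ : IsSeparatrix A C ρ x₀ Z) (hZ' : IsSeparatrix A' C ρ' x₀' Z')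
    (hρ : IsSaddleRoot A C ρ) (hρ' : IsSaddleRoot A' C ρ') (hA : A < A') {w z z' : ℝ}
    (hw : 0 < w) (h : (w, z) ∈ stableArc A C ρ) (h' : (w, z') ∈ stableArc A' C ρ') : z' < z := by
  obtain ⟨x, hx, hxw, rfl⟩ := hZ.exists_of_mem_stableArc hρ hw h
  obtain ⟨y, hy, hyw, rfl⟩ := hZ'.exists_of_mem_stableArc hρ' hw h'
  have hx0 : 0 < x := hZ.x₀_nonneg.trans_lt hx
  have hy0 : 0 < y := hZ'.x₀_nonneg.trans_lt hy
  have hle := hZ.x₀_le_x₀ hZ' hρ hρ' hA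
  have h1 := hZ.lt_of_lt hZ' hρ hρ' hA (hle.trans hy.le) hy.le
  have h2 : x * Z x < y * Z y := by
    rw [hxw, ← hyw]; exact mul_lt_mul_of_pos_left h1 hy0
  have h3 : x < y := (hZ.strictMonoOn hρ).lt_iff_lt (show x₀ ≤ x from hx.le)
    (show x₀ ≤ y from hle.trans hy.le) |>.1 h2
  have h4 := hZ'.pos y hy
  have h5 : x * Z' y < x * Z x := by
    rw [hxw, ← hyw]; exact mul_lt_mul_of_pos_right h3 h4
  exact lt_of_mul_lt_mul_left h5 hx0.le

/-- Strictness at `w = 0`: the comparison of the graphs includes `x = 0`, where the equation is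
regular. -/
theorem end_lt_end (hZ : IsSeparatrix A C ρ x₀ Z) (hZ' : IsSeparatrix A' C ρ' x₀' Z')
    (hρ : IsSaddleRoot A C ρ) (hρ' : IsSaddleRoot A' C ρ') (hA : A < A') (h : 0 < Z x₀) :
    Z' x₀' < Z x₀ := by
  rcases hZ'.end_nonneg.eq_or_lt with h0 | h0
  · rwa [← h0]
  · have h1 := hZ.x₀_eq_zero h
    have h2 := hZ'.x₀_eq_zero h0
    rw [h2, ← h1]
    exact hZ.lt_of_lt hZ' hρ hρ' hA le_rfl (by rw [h1, h2])

theorem end_eq_zero (hZ : IsSeparatrix A C ρ x₀ Z) (hZ' : IsSeparatrix A' C ρ' x₀' Z')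
    (hρ : IsSaddleRoot A C ρ) (hρ' : IsSaddleRoot A' C ρ') (hA : A < A') (h : Z x₀ = 0) :
    Z' x₀' = 0 := by
  by_contra hne
  have h0 : 0 < Z' x₀' := lt_of_le_of_ne hZ'.end_nonneg (Ne.symm hne)
  have h2 := hZ'.x₀_eq_zero h0
  have h1 : x₀ = x₀' := by linarith [hZ.x₀_nonneg, hZ.x₀_le_x₀ hZ' hρ hρ' hA]
  have := hZ.lt_of_lt hZ' hρ hρ' hA le_rfl h1.ge
  rw [h1] at this h
  linarith

end IsSeparatrix

/-! ### The roots of `f` -/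

theorem cube_lt_of_lt {α : ℝ} (h : α < -3 / (4 : ℝ) ^ ((1 : ℝ) / 3)) : 4 * α ^ 3 < -27 := by
  set c : ℝ := (4 : ℝ) ^ ((1 : ℝ) / 3) with hc
  have hc0 : 0 < c := by positivity
  have hc3 : c ^ 3 = 4 := by
    rw [hc, ← Real.rpow_natCast, ← Real.rpow_mul (by norm_num)]
    norm_num
  rw [lt_div_iff₀ hc0] at h
  have h1 : (3 : ℝ) ^ 3 < (-(α * c)) ^ 3 :=
    pow_lt_pow_left₀ (by linarith) (by norm_num) (by norm_num)
  have h2 : (-(α * c)) ^ 3 = -(4 * α ^ 3) := by rw [← hc3]; ring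
  rw [h2] at h1
  linarith

theorem roots_spec {α : ℝ} (hα : α < -3 / (4 : ℝ) ^ ((1 : ℝ) / 3)) :
    v₁ α < v₂ α ∧ v₂ α < 0 ∧ 0 < v₃ α ∧
      (∀ v, f v α = (v - v₁ α) * (v - v₂ α) * (v - v₃ α)) := by
  have h3 := cube_lt_of_lt hα
  have hα0 : α < 0 := by
    by_contra hn
    have := pow_nonneg (not_lt.1 hn) 3
    linarith
  have hc : Continuous fun v => f v α := by unfold f; fun_prop
  -- `f` is positive at its local maximum `2α/3`
  have hmax : 0 < f (2 * α / 3) α := by unfold f; nlinarith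
  have hzero : f 0 α = -1 := by unfold f; ring
  have hleft : f (α - 1) α < 0 := by unfold f; nlinarith [sq_nonneg (α - 1)]
  have hright : 0 < f (1 - α) α := by
    unfold f
    have : 0 < (1 - α) ^ 2 - 1 := by nlinarith
    nlinarith
  -- the sign changes on `α - 1 < 2α/3 < 0 < 1 - α` separate the three roots
  obtain ⟨r₁, hr₁, e₁⟩ := intermediate_value_Ioo (show α - 1 ≤ 2 * α / 3 by linarith)
    hc.continuousOn ⟨hleft, hmax⟩
  obtain ⟨r₂, hr₂, e₂⟩ := intermediate_value_Ioo' (show 2 * α / 3 ≤ 0 by linarith)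
    hc.continuousOn ⟨by rw [hzero]; norm_num, hmax⟩
  obtain ⟨r₃, hr₃, e₃⟩ := intermediate_value_Ioo (show (0 : ℝ) ≤ 1 - α by linarith)
    hc.continuousOn ⟨by rw [hzero]; norm_num, hright⟩
  have h12 : r₁ < r₂ := hr₁.2.trans hr₂.1
  have h23 : r₂ < r₃ := hr₂.2.trans hr₃.1
  simp only [f] at e₁ e₂ e₃
  have s12 : r₁ ^ 2 + r₁ * r₂ + r₂ ^ 2 - α * (r₁ + r₂) = 0 := by
    refine (mul_eq_zero.1 (?_ : (r₁ - r₂) * _ = 0)).resolve_left (by linarith)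
    linear_combination e₁ - e₂
  have s23 : r₂ ^ 2 + r₂ * r₃ + r₃ ^ 2 - α * (r₂ + r₃) = 0 := by
    refine (mul_eq_zero.1 (?_ : (r₂ - r₃) * _ = 0)).resolve_left (by linarith)
    linear_combination e₂ - e₃
  have hsum : r₁ + r₂ + r₃ - α = 0 := by
    refine (mul_eq_zero.1 (?_ : (r₁ - r₃) * _ = 0)).resolve_left (by linarith)
    linear_combination s12 - s23
  have hfac : ∀ v, f v α = (v - r₁) * (v - r₂) * (v - r₃) := fun v => by
    unfold f
    linear_combination e₁ + (v ^ 2 - r₁ ^ 2) * hsum + (v - r₁) * (s12 - (r₁ + r₂) * hsum)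
  have hroot : ∀ v, f v α = 0 ↔ v = r₁ ∨ v = r₂ ∨ v = r₃ := fun v => by
    rw [hfac, mul_eq_zero, mul_eq_zero, sub_eq_zero, sub_eq_zero, sub_eq_zero, or_assoc]
  have E₁ : v₁ α = r₁ := by
    refine IsLeast.csInf_eq ⟨(hroot r₁).2 (Or.inl rfl), fun v hv => ?_⟩
    rcases (hroot v).1 hv with rfl | rfl | rfl <;> linarith
  have E₂ : v₂ α = r₂ := by
    refine IsLeast.csInf_eq ⟨⟨(hroot r₂).2 (Or.inr (Or.inl rfl)), by rw [E₁]; exact h12⟩,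
      fun v hv => ?_⟩
    have h := hv.2
    rw [E₁] at h
    rcases (hroot v).1 hv.1 with rfl | rfl | rfl <;> linarith
  have E₃ : v₃ α = r₃ := by
    refine IsGreatest.csSup_eq ⟨(hroot r₃).2 (Or.inr (Or.inr rfl)), fun v hv => ?_⟩
    rcases (hroot v).1 hv with rfl | rfl | rfl <;> linarith
  rw [E₁, E₂, E₃]
  exact ⟨h12, hr₂.2, hr₃.1, hfac⟩

theorem isSaddleRoot_plus {α : ℝ} (hα : α < -3 / (4 : ℝ) ^ ((1 : ℝ) / 3)) :
    IsSaddleRoot (-α) (-1) (v₃ α) := by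
  obtain ⟨h12, h2, h3, hf⟩ := roots_spec hα
  have hcub : ∀ w, cubic (-α) (-1) w = (w - v₁ α) * (w - v₂ α) * (w - v₃ α) := fun w => by
    rw [← hf]; unfold cubic f; ring
  have hα0 : α < 0 := hα.trans (div_neg_of_neg_of_pos (by norm_num) (by positivity))
  refine ⟨h3, by rw [hcub]; ring, by nlinarith, fun w hw => ?_⟩
  rw [hcub]
  exact mul_pos (mul_pos (by linarith) (by linarith)) (by linarith)

theorem isSaddleRoot_minus {α : ℝ} (hα : α < -3 / (4 : ℝ) ^ ((1 : ℝ) / 3)) :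
    IsSaddleRoot α 1 (-v₁ α) := by
  obtain ⟨h12, h2, h3, hf⟩ := roots_spec hα
  have hcub : ∀ w, cubic α 1 w = (w + v₁ α) * (w + v₂ α) * (w + v₃ α) := fun w => by
    have := hf (-w)
    unfold f at this
    unfold cubic
    linear_combination -this
  refine ⟨by linarith, by rw [hcub]; ring, ?_, fun w hw => ?_⟩
  · have hs : 3 * (-v₁ α) ^ 2 + 2 * α * -v₁ α = (v₁ α - v₂ α) * (v₁ α - v₃ α) := by
      have h0 := hf 0
      have h1 := hf 1
      have hm := hf (-1)
      simp only [f] at h0 h1 hm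
      linear_combination (v₁ α + 1 / 2) * h1 + (v₁ α - 1 / 2) * hm - 2 * v₁ α * h0
    rw [hs]
    exact mul_pos_of_neg_of_neg (by linarith) (by linarith)
  · rw [hcub]
    exact mul_pos (mul_pos (by linarith) (by linarith)) (by linarith)

/-! ### Reduction of the two separatrices to the normal form -/

theorem field_eq_planar (α : ℝ) : field α = planar (-α) (-1) := by
  funext p
  simp only [field, planar, speed, cubic, f]
  ext <;> simp only <;> ring

theorem mem_arcPlus_iff {α : ℝ} (hα : α < -3 / (4 : ℝ) ^ ((1 : ℝ) / 3)) {q : ℝ × ℝ} :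
    q ∈ arcPlus α ↔ q ∈ stableArc (-α) (-1) (v₃ α) := by
  obtain ⟨h12, h2, h3, hf⟩ := roots_spec hα
  have hcub : ∀ w, cubic (-α) (-1) w = f w α := fun w => by unfold cubic f; ring
  have hspeed : ∀ p : ℝ × ℝ, p.1 * f p.1 α + p.2 ^ 2 = speed (-α) (-1) p := fun p => by
    simp only [speed, hcub]
  have harc : ∀ p, arc α p = planarArc (-α) (-1) p := fun p => by
    simp only [arc, planarArc, IsSolutionOn, field_eq_planar, hspeed]
  simp only [arcPlus, mem_iUnion, harc, exists_prop]
  constructor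
  · rintro ⟨p, ⟨⟨hz, γ, rfl, hsol, ht⟩, -, hp2, -⟩, hq⟩
    rw [IsSolutionOn, field_eq_planar] at hsol
    refine mem_stableArc_of_mem_planarArc (isSaddleRoot_plus hα) ⟨hsol, hz, ht⟩
      (fun w hw hw0 => ?_) hq
    rw [hcub, hf]
    refine mul_nonneg_of_nonpos_of_nonpos hw0 (mul_nonpos_of_nonneg_of_nonpos
      (mul_nonneg ?_ ?_) ?_) <;> linarith
  · intro hq
    obtain ⟨γ, ho, h1, h2', h3', hq'⟩ := exists_near_saddle_of_mem_stableArc hq (h2.trans h3)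
    refine ⟨γ 0, ⟨⟨ho.start, γ, rfl, ?_, ho.tendsto⟩, ho.start, h1.le, h2', ?_⟩, hq'⟩
    · rw [IsSolutionOn, field_eq_planar]
      exact ho.sol
    · rw [hspeed]; exact h3'

/-- The reflection `v ↦ -v`. Together with time reversal it carries the system with parameter `α`
to the normal form with `g = cubic α 1`, and `P₁` to the stable end point `(-v₁, 0)`. -/
def mirror (p : ℝ × ℝ) : ℝ × ℝ := (-p.1, p.2)

theorem mirror_mirror (p : ℝ × ℝ) : mirror (mirror p) = p := by simp [mirror]

theorem cubic_neg (α v : ℝ) : cubic α 1 (-v) = -f v α := by unfold cubic f; ring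

theorem speed_mirror (α : ℝ) (p : ℝ × ℝ) :
    speed α 1 (mirror p) = p.1 * f p.1 α + p.2 ^ 2 := by
  simp only [speed, mirror, cubic_neg]; ring

theorem hasDerivWithinAt_mirror {γ : ℝ → ℝ × ℝ} {c : ℝ × ℝ} {J : Set ℝ} {t : ℝ}
    (h : HasDerivWithinAt γ c J t) : HasDerivWithinAt (fun t => mirror (γ t)) (mirror c) J t :=
  ((hasFDerivAt_fst (𝕜 := ℝ) (p := γ t)).comp_hasDerivWithinAt t h).neg.prodMk
    ((hasFDerivAt_snd (𝕜 := ℝ) (p := γ t)).comp_hasDerivWithinAt t h)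

theorem planar_mirror (α : ℝ) (p : ℝ × ℝ) : planar α 1 (mirror p) = mirror (-field α p) := by
  simp only [planar, speed_mirror]
  simp [mirror, field, cubic_neg]

theorem field_mirror (α : ℝ) (p : ℝ × ℝ) : field α (mirror p) = mirror (-planar α 1 p) := by
  have := planar_mirror α (mirror p)
  rw [mirror_mirror] at this
  rw [this]
  simp [mirror]

theorem isIntegralCurveOn_mirror {α : ℝ} {γ : ℝ → ℝ × ℝ} {J J' : Set ℝ} (h : IsSolutionOn α γ J)
    (hJ : ∀ t ∈ J', -t ∈ J) :
    IsIntegralCurveOn (fun t => mirror (γ (-t))) (fun _ => planar α 1) J' := fun t ht => by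
  beta_reduce
  rw [planar_mirror]
  exact hasDerivWithinAt_mirror (isIntegralCurveOn_comp_neg h hJ t ht)

theorem isSolutionOn_mirror {α : ℝ} {γ : ℝ → ℝ × ℝ} {J J' : Set ℝ}
    (h : IsIntegralCurveOn γ (fun _ => planar α 1) J) (hJ : ∀ t ∈ J', -t ∈ J) :
    IsSolutionOn α (fun t => mirror (γ (-t))) J' := fun t ht => by
  beta_reduce
  rw [field_mirror]
  exact hasDerivWithinAt_mirror (isIntegralCurveOn_comp_neg h hJ t ht)

theorem neg_mem_uIcc {T t : ℝ} (h : t ∈ uIcc 0 (-T)) : -t ∈ uIcc 0 T := by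
  rw [mem_uIcc] at h ⊢
  rcases h with ⟨h1, h2⟩ | ⟨h1, h2⟩
  · right; constructor <;> linarith
  · left; constructor <;> linarith

theorem mirror_mem_planarArc {α : ℝ} {p q : ℝ × ℝ} (h : q ∈ arc α p) :
    mirror q ∈ planarArc α 1 (mirror p) := by
  obtain ⟨T, γ, rfl, rfl, hsol, hpos⟩ := h
  refine ⟨-T, fun t => mirror (γ (-t)), by simp, by simp,
    isIntegralCurveOn_mirror hsol fun t ht => neg_mem_uIcc ht, fun t ht => ?_⟩
  rw [speed_mirror]
  exact hpos _ (neg_mem_uIcc ht)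

theorem mirror_mem_arc {α : ℝ} {p q : ℝ × ℝ} (h : q ∈ planarArc α 1 p) :
    mirror q ∈ arc α (mirror p) := by
  obtain ⟨T, γ, rfl, rfl, hsol, hpos⟩ := h
  refine ⟨-T, fun t => mirror (γ (-t)), by simp, by simp,
    isSolutionOn_mirror hsol fun t ht => neg_mem_uIcc ht, fun t ht => ?_⟩
  rw [← speed_mirror, mirror_mirror]
  exact hpos _ (neg_mem_uIcc ht)

theorem tendsto_mirror {γ : ℝ → ℝ × ℝ} {l : Filter ℝ} {c : ℝ × ℝ} (h : Tendsto γ l (𝓝 c)) :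
    Tendsto (fun t => mirror (γ t)) l (𝓝 (mirror c)) := by
  have hc : Continuous mirror := by unfold mirror; fun_prop
  exact (hc.tendsto c).comp h

theorem mem_arcMinus_iff {α : ℝ} (hα : α < -3 / (4 : ℝ) ^ ((1 : ℝ) / 3)) {q : ℝ × ℝ} :
    q ∈ arcMinus α ↔ mirror q ∈ stableArc α 1 (-v₁ α) := by
  obtain ⟨h12, h2, h3, hf⟩ := roots_spec hα
  simp only [arcMinus, mem_iUnion, exists_prop]
  constructor
  · rintro ⟨p, ⟨⟨hz, γ, rfl, hsol, ht⟩, -, -, hp2, -⟩, hq⟩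
    have hq' := mirror_mem_planarArc hq
    have ho : IsStableOrbit α 1 (-v₁ α) fun t => mirror (γ (-t)) := by
      refine ⟨isIntegralCurveOn_mirror hsol fun t ht => ?_, by simpa [mirror] using hz, ?_⟩
      · rw [mem_Ici] at ht
        rw [mem_Iic]; linarith
      · exact tendsto_mirror (ht.comp tendsto_neg_atTop_atBot)
    refine mem_stableArc_of_mem_planarArc (isSaddleRoot_minus hα) ho (fun w hw hw0 => ?_)
      (by simpa using hq')
    simp only [mirror, neg_zero] at hw
    linarith
  · intro hq
    obtain ⟨γ, ho, h1, h2', h3', hq'⟩ := exists_near_saddle_of_mem_stableArc hq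
      (show -v₂ α < -v₁ α by linarith)
    have hm := mirror_mem_arc hq'
    rw [mirror_mirror] at hm
    refine ⟨mirror (γ 0), ⟨⟨ho.start, fun t => mirror (γ (-t)), by simp,
      isSolutionOn_mirror ho.sol fun t ht => ?_, ?_⟩, ho.start, ?_, ?_, ?_⟩, hm⟩
    · rw [mem_Iic] at ht
      rw [mem_Ici]; linarith
    · have := tendsto_mirror (ho.tendsto.comp tendsto_neg_atBot_atTop)
      simpa [mirror] using this
    · simp only [mirror]; linarith
    · simp only [mirror]; linarith
    · rw [← speed_mirror, mirror_mirror]; exact h3'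

/-! ### The functions `φ⁻` and `φ⁺` -/

theorem existsUnique_arcPlus {α : ℝ} (hα : α < -3 / (4 : ℝ) ^ ((1 : ℝ) / 3)) {v : ℝ}
    (h1 : vPlus α < v) (h2 : v < v₃ α) :
    ∃! z : ℝ, (v, z) ∈ arcPlus α := by
  simp only [vPlus, iInf_lt_iff] at h1
  obtain ⟨p, hp, hpv⟩ := h1
  simp only [mem_arcPlus_iff hα] at hp ⊢
  obtain ⟨z, hz⟩ := exists_mem_stableArc_of_le (w := p.1) (z := p.2) hp
    (EReal.coe_lt_coe_iff.1 hpv).le h2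
  exact ⟨z, hz, fun z' hz' => stableArc_height_unique (isSaddleRoot_plus hα) hz' hz⟩

theorem existsUnique_arcMinus {α : ℝ} (hα : α < -3 / (4 : ℝ) ^ ((1 : ℝ) / 3)) {v : ℝ}
    (h1 : v₁ α < v) (h2 : v < vMinus α) :
    ∃! z : ℝ, (v, z) ∈ arcMinus α := by
  simp only [vMinus, lt_iSup_iff] at h2
  obtain ⟨p, hp, hpv⟩ := h2
  simp only [mem_arcMinus_iff hα] at hp ⊢
  obtain ⟨z, hz⟩ := exists_mem_stableArc_of_le (w := -p.1) (z := p.2) (w' := -v) hp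
    (by linarith [EReal.coe_lt_coe_iff.1 hpv]) (by linarith)
  exact ⟨z, hz, fun z' hz' => stableArc_height_unique (isSaddleRoot_minus hα) hz' hz⟩

theorem height_mem {S : Set (ℝ × ℝ)} {v : ℝ} (h : ∃! z : ℝ, (v, z) ∈ S) : (v, height S v) ∈ S :=
  Classical.epsilon_spec h.exists

/-- `φ⁺` is the height of the stable separatrix on `[0, v₃)`, including at `v = 0`. -/
theorem phiPlus_spec {α : ℝ} (hα : α < -3 / (4 : ℝ) ^ ((1 : ℝ) / 3)) :
    ∃ x₀ Z, IsSeparatrix (-α) (-1) (v₃ α) x₀ Z ∧ 0 < Z x₀ ∧ vPlus α < 0 ∧ phiPlus 0 α = Z x₀ ∧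
      ∀ v, 0 < v → v < v₃ α → (v, phiPlus v α) ∈ stableArc (-α) (-1) (v₃ α) := by
  obtain ⟨h12, h2, h3, hf⟩ := roots_spec hα
  have hρ := isSaddleRoot_plus hα
  obtain ⟨x₀, Z, hZ⟩ := hρ.exists_isSeparatrix
  have hend : 0 < Z x₀ := hZ.end_pos_of_neg hρ fun w hw hw' => by
    have : cubic (-α) (-1) w = f w α := by unfold cubic f; ring
    rw [this, hf]
    exact mul_neg_of_pos_of_neg (mul_pos (by linarith) (by linarith)) (by linarith)
  obtain ⟨h0, w, hw, z, hz⟩ := hZ.exists_past_mem_stableArc hρ hend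
  have hplus : vPlus α < 0 := by
    refine lt_of_le_of_lt (iInf₂_le (w, z) ((mem_arcPlus_iff hα).2 hz)) ?_
    exact_mod_cast hw
  have hmem : ∀ v : ℝ, 0 ≤ v → v < v₃ α → (v, phiPlus v α) ∈ stableArc (-α) (-1) (v₃ α) :=
    fun v hv hv' => (mem_arcPlus_iff hα).1
      (height_mem (existsUnique_arcPlus hα (hplus.trans_le (by exact_mod_cast hv)) hv'))
  exact ⟨x₀, Z, hZ, hend, hplus, stableArc_height_unique hρ (hmem 0 le_rfl h3) h0,
    fun v hv hv' => hmem v hv.le hv'⟩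

/-- `φ⁻` is the height of the mirrored separatrix on `(v₁, 0)`; its value and limit at `0` is the
end height `Z x₀`, both when the separatrix crosses the `z`-axis and when it ends at the origin. -/
theorem phiMinus_spec {α : ℝ} (hα : α < -3 / (4 : ℝ) ^ ((1 : ℝ) / 3)) :
    ∃ x₀ Z, IsSeparatrix α 1 (-v₁ α) x₀ Z ∧ 0 ≤ vMinus α ∧ (vMinus α = 0 ↔ Z x₀ = 0) ∧
      phiMinus 0 α = Z x₀ ∧
      Tendsto (fun v => phiMinus v α) (𝓝[<] 0) (𝓝 (Z x₀)) ∧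
      ∀ v, v₁ α < v → v < 0 → (-v, phiMinus v α) ∈ stableArc α 1 (-v₁ α) := by
  obtain ⟨h12, h2, h3, hf⟩ := roots_spec hα
  have hρ := isSaddleRoot_minus hα
  obtain ⟨x₀, Z, hZ⟩ := hρ.exists_isSeparatrix
  have hlt : ∀ v : ℝ, v₁ α < v → v < 0 → (v : EReal) < vMinus α := fun v hv hv' => by
    obtain ⟨x, hx, hxw⟩ := hZ.exists_eq (w := -v / 2) (by linarith) (by linarith)
    have hm := hZ.mem_stableArc hρ hx
    rw [hxw] at hm
    have hm' : (v / 2, Z x) ∈ arcMinus α := by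
      rw [mem_arcMinus_iff hα]
      simp only [mirror]
      rwa [← neg_div]
    refine lt_of_lt_of_le ?_ (le_iSup₂ (f := fun (p : ℝ × ℝ) (_ : p ∈ arcMinus α) => (p.1 : EReal))
      (v / 2, Z x) hm')
    exact EReal.coe_lt_coe_iff.2 (by simp only; linarith)
  have hmem' : ∀ v : ℝ, v₁ α < v → (v : EReal) < vMinus α →
      (-v, height (arcMinus α) v) ∈ stableArc α 1 (-v₁ α) := fun v hv hv' =>
    (mem_arcMinus_iff hα).1 (height_mem (existsUnique_arcMinus hα hv hv'))
  have hphi : ∀ v : ℝ, (v : EReal) < vMinus α → phiMinus v α = height (arcMinus α) v :=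
    fun v hv => if_pos hv
  have hge : 0 ≤ vMinus α := by
    by_contra hneg
    obtain ⟨x, hx1, hx2⟩ := EReal.lt_iff_exists_real_btwn.1 (not_le.1 hneg)
    have hx0 : x < 0 := by exact_mod_cast hx2
    have h1 := hlt (max x (v₁ α / 2)) (lt_max_of_lt_right (by linarith))
      (max_lt hx0 (by linarith))
    have h4 : (x : EReal) ≤ (max x (v₁ α / 2) : ℝ) := EReal.coe_le_coe_iff.2 (le_max_left _ _)
    exact absurd (hx1.trans_le h4) (not_lt.2 h1.le)
  have htend : Tendsto (height (arcMinus α)) (𝓝[<] 0) (𝓝 (Z x₀)) := by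
    have h1 := hZ.tendsto_height hρ (η := fun w => height (arcMinus α) (-w)) fun w hw hw' => by
      have := hmem' (-w) (by linarith) (hlt (-w) (by linarith) (by linarith))
      rwa [neg_neg] at this
    have h4 : Tendsto (fun v : ℝ => -v) (𝓝[<] 0) (𝓝[>] 0) := by
      simpa using tendsto_neg_nhdsLT (a := (0 : ℝ))
    simpa [Function.comp_def] using h1.comp h4
  have hiff : vMinus α = 0 ↔ Z x₀ = 0 := by
    constructor
    · intro h0
      by_contra hne
      have hpos : 0 < Z x₀ := lt_of_le_of_ne hZ.end_nonneg (Ne.symm hne)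
      obtain ⟨-, w, hw, z, hz⟩ := hZ.exists_past_mem_stableArc hρ hpos
      have hm : (-w, z) ∈ arcMinus α := by
        rw [mem_arcMinus_iff hα]
        simpa [mirror] using hz
      have h1 := le_iSup₂ (f := fun (p : ℝ × ℝ) (_ : p ∈ arcMinus α) => (p.1 : EReal)) (-w, z) hm
      have h4 : ((-w : ℝ) : EReal) ≤ 0 := h1.trans h0.le
      have : -w ≤ 0 := by exact_mod_cast h4
      linarith
    · intro h0
      refine le_antisymm (iSup₂_le fun p hp => ?_) hge
      have := hZ.pos_of_mem_stableArc hρ h0 ((mem_arcMinus_iff hα).1 hp)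
      simp only [mirror] at this
      have h4 : p.1 ≤ 0 := by linarith
      exact_mod_cast h4
  refine ⟨x₀, Z, hZ, hge, hiff, ?_, ?_, fun v hv hv' => ?_⟩
  · rcases hge.eq_or_lt with h0 | h0
    · have : phiMinus 0 α = limUnder (𝓝[<] 0) (height (arcMinus α)) :=
        if_neg (by rw [← h0]; simp)
      rw [this]
      exact htend.limUnder_eq
    · have hpos : 0 < Z x₀ := lt_of_le_of_ne hZ.end_nonneg fun h => h0.ne' (hiff.2 h.symm)
      have h1 := hmem' 0 (by linarith) (by exact_mod_cast h0)
      rw [hphi 0 (by exact_mod_cast h0)]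
      rw [neg_zero] at h1
      exact stableArc_height_unique hρ h1 (hZ.exists_past_mem_stableArc hρ hpos).1
  · refine htend.congr' ?_
    filter_upwards [Ioo_mem_nhdsLT (show v₁ α < 0 by linarith)] with v hv
    exact (hphi v (hlt v hv.1 hv.2)).symm
  · rw [hphi v (hlt v hv hv')]
    exact hmem' v hv (hlt v hv hv')

end RotatedSystem

end

theorem mainTheorem4 (a b : ℝ) (hba : b < a) (ha : a < -3 / (4 : ℝ) ^ ((1 : ℝ) / 3)) :
    -- the heights are well defined for both parameters
    (∀ α : ℝ, α = a ∨ α = b →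
      (0 ≤ RotatedSystem.vMinus α ∧
        (∀ v : ℝ, RotatedSystem.v₁ α < v → (v : EReal) < RotatedSystem.vMinus α →
          ∃! z : ℝ, (v, z) ∈ RotatedSystem.arcMinus α) ∧
        Tendsto (fun v => RotatedSystem.phiMinus v α) (𝓝[<] 0)
          (𝓝 (RotatedSystem.phiMinus 0 α))) ∧
      (RotatedSystem.vPlus α < 0 ∧
        ∀ v : ℝ, RotatedSystem.vPlus α < (v : EReal) → v < RotatedSystem.v₃ α →
          ∃! z : ℝ, (v, z) ∈ RotatedSystem.arcPlus α)) ∧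
    -- comparison of the unstable separatrices
    (∀ v ∈ Ioc (RotatedSystem.v₁ a) 0,
      RotatedSystem.phiMinus v a ≤ RotatedSystem.phiMinus v b ∧
      (RotatedSystem.phiMinus v a = RotatedSystem.phiMinus v b ↔
        (v : EReal) = RotatedSystem.vMinus b ∧ RotatedSystem.vMinus b = 0)) ∧
    (RotatedSystem.vMinus b = 0 ↔ RotatedSystem.phiMinus 0 b = 0) ∧
    -- comparison of the stable separatrices
    (∀ v ∈ Ico 0 (RotatedSystem.v₃ b),
      RotatedSystem.phiPlus v b < RotatedSystem.phiPlus v a) := by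
  have hb : b < -3 / (4 : ℝ) ^ ((1 : ℝ) / 3) := hba.trans ha
  obtain ⟨-, h2b, h3b, -⟩ := RotatedSystem.roots_spec hb
  have hma := RotatedSystem.isSaddleRoot_minus ha
  have hmb := RotatedSystem.isSaddleRoot_minus hb
  have hpa := RotatedSystem.isSaddleRoot_plus ha
  have hpb := RotatedSystem.isSaddleRoot_plus hb
  obtain ⟨xa, Za, hZa, -, -, hφa, -, hmema⟩ := RotatedSystem.phiMinus_spec ha
  obtain ⟨xb, Zb, hZb, -, hiff, hφb, -, hmemb⟩ := RotatedSystem.phiMinus_spec hb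
  refine ⟨?_, fun v hv => ?_, ?_, fun v hv => ?_⟩
  · intro α hα
    have hα' : α < -3 / (4 : ℝ) ^ ((1 : ℝ) / 3) := by rcases hα with rfl | rfl <;> assumption
    obtain ⟨_, _, _, hge, -, hφ, ht, -⟩ := RotatedSystem.phiMinus_spec hα'
    obtain ⟨_, _, _, -, hlt, -⟩ := RotatedSystem.phiPlus_spec hα'
    rw [← hφ] at ht
    exact ⟨⟨hge, fun v h1 h2 => RotatedSystem.existsUnique_arcMinus hα' h1 h2, ht⟩, hlt,
      fun v h1 h2 => RotatedSystem.existsUnique_arcPlus hα' h1 h2⟩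
  · rcases hv.2.eq_or_lt with rfl | hv0
    · rw [hφa, hφb, hiff]
      rcases hZb.end_nonneg.eq_or_lt with h0 | h0
      · have h1 := hZb.end_eq_zero hZa hmb hma hba h0.symm
        rw [h1, ← h0, hiff.2 h0.symm]
        simp
      · have h1 := hZb.end_lt_end hZa hmb hma hba h0
        exact ⟨h1.le, fun h => absurd h h1.ne, fun h => absurd h.2 h0.ne'⟩
    · have hroot := hmb.lt_of_lt hma hba
      have h1 := hZb.height_lt_height hZa hmb hma hba (by linarith)
        (hmemb v (by linarith [hv.1]) hv0) (hmema v hv.1 hv0)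
      refine ⟨h1.le, fun h => absurd h h1.ne, fun h => ?_⟩
      rw [h.2] at h
      exact absurd (by exact_mod_cast h.1) hv0.ne
  · rw [hiff, hφb]
  · obtain ⟨ya, Wa, hWa, hea, -, hψa, hna⟩ := RotatedSystem.phiPlus_spec ha
    obtain ⟨yb, Wb, hWb, -, -, hψb, hnb⟩ := RotatedSystem.phiPlus_spec hb
    have hba' : -a < -b := by linarith
    rcases hv.1.eq_or_lt with rfl | hv0
    · rw [hψa, hψb]
      exact hWa.end_lt_end hWb hpa hpb hba' hea
    · have hroot := hpa.lt_of_lt hpb hba'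
      exact hWa.height_lt_height hWb hpa hpb hba' hv0 (hna v hv0 (hv.2.trans hroot))
        (hnb v hv0 hv.2)
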